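/- Let $\mathcal T$ be a finite double groupoid with set of boxes $\mathcal B$, groupoid of horizontal edges $\mathcal H\rightrightarrows\mathcal P$ (source $l$, target $r$) and groupoid of vertical edges $\mathcal V\rightrightarrows\mathcal P$ (source $t$, target $b$). A box $A$ has top, bottom, left and right edges $t(A),b(A)\in\mathcal H$, $l(A),r(A)\in\mathcal V$; its bottom left vertex is denoted $bl(A)$. The core groupoid $\mathbf D\rightrightarrows\mathcal P$ has as arrows the boxes $D$ whose left and bottom edges are identities, with source the upper right vertex of $D$, target the upper left vertex of $D$, and identities the boxes $\Theta_P=\mathrm{id}\,\mathrm{id}_P$. The composition $D\diamond L$ is the box $\mathrm{id}\,t(L)\cdot D$ (horizontal product) placed on top of $L$. Let $\Bbbk$ be a field of characteristic zero. For $\vartheta:\mathcal P\to\Bbbk^\times$, let $\Bbbk^{(\vartheta)}\mathcal T$ be the $\Bbbk$-vector space with basis $\mathcal B$, with multiplication $A\cdot C=$ the vertical composition of $A$ (on top) and $C$ if $b(A)=t(C)$, and $A\cdot C=0$ otherwise; unit $\sum_{x\in\mathcal H}\mathrm{id}\,x$; comultiplication $\Delta(A)=\sum_{XY=A}\vartheta(bl(Y))\,X\otimes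 Y$ (sum over horizontal factorizations); and counit $\varepsilon(A)=\vartheta(bl(A))^{-1}$ if $A$ is the horizontal identity of a vertical edge, and $\varepsilon(A)=0$ otherwise. A weak Hopf algebra is called regular if its antipode $\mathcal S$ satisfies $\mathcal S^2=\mathrm{id}$ on the source and target subalgebras, i.e. on the images of $\epsilon_s(h)=(\mathrm{id}\otimes\varepsilon)((1\otimes h)\Delta(1))$ and $\epsilon_t(h)=(\varepsilon\otimes\mathrm{id})(\Delta(1)(h\otimes1))$. (1) Suppose that $$\sum_{U\in\mathcal B:\ t(U)=x,\ r(U)=g}\vartheta(bl(U))=1\qquad\text{for all } x\in\mathcal H,\ g\in\mathcal V \text{ with } r(x)=t(g).$$ Then $\Bbbk^{(\vartheta)}\mathcal T$ is a weak Hopf algebra, and it is regular if and only if $\vartheta$ is constant on the connected components of $\mathcal P$ defined by the core groupoid $\mathbf D$. (2) Suppose that $\mathcal T$ satisfies the filling condition: for all $x\in\mathcal H$, $g\in\mathcal V$ with $r(x)=t(g)$ there is a box with top edge $x$ and right edge $g$. Let $\Bbbk\mathcal T$ be the vector space with basis $\mathcal B$, with the same multiplication and unit as above, comultiplication $\Delta(A)=\sum_{XY=A}\frac1{\urcorner(Y)}X\otimes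 Y$, and counit $\varepsilon(A)=\urcorner(A)$ if $A$ is the horizontal identity of a vertical edge and $\varepsilon(A)=0$ otherwise, where $\urcorner(Y)$ is the number of boxes with the same top and right edges as $Y$. Then $\Bbbk\mathcal T$ is a regular weak Hopf algebra. -/

import Mathlib

open scoped TensorProduct



/-! ## Groupoids and double groupoids -/

/-- A groupoid `A ⇉ O` with set of arrows `A` and base `O`, presented by its structure maps.
Composition is written from left to right: `comp f g` is defined when `tgt f = src g`. -/
structure ArrowGroupoid (O A : Type*) where
  src : A → O
  tgt : A → O
  id : O → A
  comp : (f g : A) → tgt f = src g → A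
  inv : A → A
  src_id : ∀ p, src (id p) = p
  tgt_id : ∀ p, tgt (id p) = p
  src_comp : ∀ f g h, src (comp f g h) = src f
  tgt_comp : ∀ f g h, tgt (comp f g h) = tgt g
  id_comp : ∀ f (h : tgt (id (src f)) = src f), comp (id (src f)) f h = f
  comp_id : ∀ f (h : tgt f = src (id (tgt f))), comp f (id (tgt f)) h = f
  assoc : ∀ f g h (h₁ : tgt f = src g) (h₂ : tgt g = src h)
    (h₃ : tgt (comp f g h₁) = src h) (h₄ : tgt f = src (comp g h h₂)),
    comp (comp f g h₁) h h₃ = comp f (comp g h h₂) h₄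
  src_inv : ∀ f, src (inv f) = tgt f
  tgt_inv : ∀ f, tgt (inv f) = src f
  comp_inv : ∀ f (h : tgt f = src (inv f)), comp f (inv f) h = id (src f)
  inv_comp : ∀ f (h : tgt (inv f) = src f), comp (inv f) f h = id (tgt f)

namespace ArrowGroupoid

variable {O A : Type*} (G : ArrowGroupoid O A)

/-- The arrow `f` is an identity, i.e. it belongs to the base `O`, viewed as a subset of `A`. -/
def IsId (f : A) : Prop := ∃ p, f = G.id p

/-- Two points of the base lie in the same connected component of the groupoid: there is an
arrow from one to the other. -/
def Connected (p q : O) : Prop := ∃ f, G.src f = p ∧ G.tgt f = q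

variable {G}

theorem comp_congr {f f' g g' : A} (hf : f = f') (hg : g = g') (h : G.tgt f = G.src g)
    (h' : G.tgt f' = G.src g') : G.comp f g h = G.comp f' g' h' := by
  subst hf hg; rfl

theorem id_comp' {f : A} {p : O} (h : G.tgt (G.id p) = G.src f) : G.comp (G.id p) f h = f := by
  obtain rfl : p = G.src f := by rw [← h, G.tgt_id]
  exact G.id_comp f h

theorem comp_id' {f : A} {p : O} (h : G.tgt f = G.src (G.id p)) : G.comp f (G.id p) h = f := by
  obtain rfl : p = G.tgt f := by rw [h, G.src_id]
  exact G.comp_id f h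

/-- Uniqueness of inverses. -/
theorem eq_inv_of_comp {f g : A} (h : G.tgt f = G.src g) (hfg : G.comp f g h = G.id (G.src f)) :
    g = G.inv f := by
  have h₁ : G.tgt (G.inv f) = G.src f := G.tgt_inv f
  have e₁ := G.assoc (G.inv f) f g h₁ h (by rw [G.tgt_comp, h]) (by rw [G.src_comp, h₁])
  have e₂ : G.comp (G.comp (G.inv f) f h₁) g (by rw [G.tgt_comp, h]) = g := by
    rw [comp_congr (G.inv_comp f h₁) rfl _ (by rw [G.tgt_id, h])]
    exact id_comp' _
  have e₃ : G.comp (G.inv f) (G.comp f g h) (by rw [G.src_comp, h₁]) = G.inv f := by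
    rw [comp_congr rfl hfg _ (by rw [G.src_id, h₁])]
    exact comp_id' _
  rw [← e₂, e₁, e₃]

end ArrowGroupoid

/-- A double groupoid: a groupoid object in the category of groupoids, presented by four groupoids

```
B ⇉ H
⇊   ⇊
V ⇉ P
```

The horizontal edges `H ⇉ P` have source `l` and target `r`, the vertical edges `V ⇉ P` have source
`t` and target `b`, vertical composition of boxes is `B ⇉ H` with source `t` (top) and target `b`
(bottom), and horizontal composition of boxes is `B ⇉ V` with source `l` (left) and target `r`
(right). The axioms say that all structure maps of `B ⇉ V` over `H ⇉ P` are functors. The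
composability hypotheses beyond the first one or the first four in each axiom are consequences of
the other axioms. -/
structure DoubleGroupoid (P H V B : Type*) where
  hor : ArrowGroupoid P H
  ver : ArrowGroupoid P V
  boxV : ArrowGroupoid H B
  boxH : ArrowGroupoid V B
  /-- the four vertices of a box -/
  lt_eq_tl : ∀ A, hor.src (boxV.src A) = ver.src (boxH.src A)
  rt_eq_tr : ∀ A, hor.tgt (boxV.src A) = ver.src (boxH.tgt A)
  lb_eq_bl : ∀ A, hor.src (boxV.tgt A) = ver.tgt (boxH.src A)
  rb_eq_br : ∀ A, hor.tgt (boxV.tgt A) = ver.tgt (boxH.tgt A)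
  /-- boundary of a horizontal composition -/
  t_hcomp : ∀ A B h h', boxV.src (boxH.comp A B h) = hor.comp (boxV.src A) (boxV.src B) h'
  b_hcomp : ∀ A B h h', boxV.tgt (boxH.comp A B h) = hor.comp (boxV.tgt A) (boxV.tgt B) h'
  /-- boundary of a vertical composition -/
  l_vcomp : ∀ A B h h', boxH.src (boxV.comp A B h) = ver.comp (boxH.src A) (boxH.src B) h'
  r_vcomp : ∀ A B h h', boxH.tgt (boxV.comp A B h) = ver.comp (boxH.tgt A) (boxH.tgt B) h'
  /-- the vertical identity of a horizontal edge has identities on its left and right -/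
  l_vid : ∀ x, boxH.src (boxV.id x) = ver.id (hor.src x)
  r_vid : ∀ x, boxH.tgt (boxV.id x) = ver.id (hor.tgt x)
  /-- the horizontal identity of a vertical edge has identities on its top and bottom -/
  t_hid : ∀ g, boxV.src (boxH.id g) = hor.id (ver.src g)
  b_hid : ∀ g, boxV.tgt (boxH.id g) = hor.id (ver.tgt g)
  vid_comp : ∀ x y h h', boxV.id (hor.comp x y h) = boxH.comp (boxV.id x) (boxV.id y) h'
  hid_comp : ∀ g k h h', boxH.id (ver.comp g k h) = boxV.comp (boxH.id g) (boxH.id k) h'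
  vid_id : ∀ p, boxV.id (hor.id p) = boxH.id (ver.id p)
  /-- the interchange law -/
  interchange : ∀ A B C D (hAB : boxH.tgt A = boxH.src B) (hCD : boxH.tgt C = boxH.src D)
    (hAC : boxV.tgt A = boxV.src C) (hBD : boxV.tgt B = boxV.src D)
    (h : boxV.tgt (boxH.comp A B hAB) = boxV.src (boxH.comp C D hCD))
    (h' : boxH.tgt (boxV.comp A C hAC) = boxH.src (boxV.comp B D hBD)),
    boxV.comp (boxH.comp A B hAB) (boxH.comp C D hCD) h =
      boxH.comp (boxV.comp A C hAC) (boxV.comp B D hBD) h'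

namespace DoubleGroupoid

variable {P H V B : Type*} (T : DoubleGroupoid P H V B)

/-- top edge -/
abbrev t (A : B) : H := T.boxV.src A
/-- bottom edge -/
abbrev b (A : B) : H := T.boxV.tgt A
/-- left edge -/
abbrev l (A : B) : V := T.boxH.src A
/-- right edge -/
abbrev r (A : B) : V := T.boxH.tgt A
/-- horizontal composition `AC` -/
abbrev hcomp (A C : B) (h : T.r A = T.l C) : B := T.boxH.comp A C h
/-- vertical composition, `A` on top of `C` -/
abbrev vcomp (A C : B) (h : T.b A = T.t C) : B := T.boxV.comp A C h
/-- vertical identity of a horizontal edge -/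
abbrev vid (x : H) : B := T.boxV.id x
/-- horizontal identity of a vertical edge -/
abbrev hid (g : V) : B := T.boxH.id g
/-- bottom left vertex -/
abbrev bl (A : B) : P := T.ver.tgt (T.l A)

/-! ### The core groupoid -/

/-- Boxes whose left and bottom edges are identities. -/
def IsCore (D : B) : Prop := T.ver.IsId (T.l D) ∧ T.hor.IsId (T.b D)

/-- The set of arrows of the core groupoid. -/
abbrev Core : Type _ := {D : B // T.IsCore D}

variable {T}

theorem IsCore.l_eq {D : B} (hD : T.IsCore D) : T.l D = T.ver.id (T.hor.src (T.t D)) := by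
  obtain ⟨⟨p, hp⟩, -⟩ := hD
  have := T.lt_eq_tl D
  change T.l D = _ at hp
  rw [hp, T.lt_eq_tl D]
  change _ = T.ver.id (T.ver.src (T.l D))
  rw [hp, T.ver.src_id]

theorem IsCore.b_eq {D : B} (hD : T.IsCore D) : T.b D = T.hor.id (T.hor.src (T.t D)) := by
  obtain ⟨p, hp⟩ := hD.2
  have h := T.lb_eq_bl D
  change T.hor.src (T.b D) = T.ver.tgt (T.l D) at h
  rw [hD.l_eq, hp, T.hor.src_id, T.ver.tgt_id] at h
  rw [hp, h]

theorem comp_tb {A C : B} (h : T.r A = T.l C) : T.hor.tgt (T.b A) = T.hor.src (T.b C) := by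
  rw [T.rb_eq_br, T.lb_eq_bl]; exact congrArg _ h

theorem comp_tt {A C : B} (h : T.r A = T.l C) : T.hor.tgt (T.t A) = T.hor.src (T.t C) := by
  rw [T.rt_eq_tr, T.lt_eq_tl]; exact congrArg _ h

theorem comp_ll {A C : B} (h : T.b A = T.t C) : T.ver.tgt (T.l A) = T.ver.src (T.l C) := by
  rw [← T.lb_eq_bl, ← T.lt_eq_tl]; exact congrArg _ h

theorem comp_rr {A C : B} (h : T.b A = T.t C) : T.ver.tgt (T.r A) = T.ver.src (T.r C) := by
  rw [← T.rb_eq_br, ← T.rt_eq_tr]; exact congrArg _ h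

/-- `vid x` and a core box `D` are horizontally composable as soon as the vertices match. -/
theorem IsCore.vid_comp {D : B} (hD : T.IsCore D) {x : H}
    (h : T.hor.tgt x = T.hor.src (T.t D)) : T.r (T.vid x) = T.l D := by
  rw [hD.l_eq, ← h]; exact T.r_vid x

theorem IsCore.b_vid_hcomp {D : B} (hD : T.IsCore D) {x : H} (h : T.r (T.vid x) = T.l D) :
    T.b (T.hcomp (T.vid x) D h) = x := by
  have e : T.b (T.vid x) = x := T.boxV.tgt_id x
  have e' := T.b_hcomp (T.vid x) D h (comp_tb h)
  refine e'.trans ?_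
  have hb := hD.b_eq
  rw [ArrowGroupoid.comp_congr e hb _ (by rw [← hb]; simpa only [e] using comp_tb h)]
  exact ArrowGroupoid.comp_id' _

theorem IsCore.t_vid_hcomp {D : B} {x : H} (h : T.r (T.vid x) = T.l D)
    (h' : T.hor.tgt x = T.hor.src (T.t D)) :
    T.t (T.hcomp (T.vid x) D h) = T.hor.comp x (T.t D) h' := by
  have e : T.t (T.vid x) = x := T.boxV.src_id x
  exact (T.t_hcomp _ _ h (comp_tt h)).trans (ArrowGroupoid.comp_congr e rfl _ _)

theorem IsCore.l_vid_hcomp {D : B} {x : H} (h : T.r (T.vid x) = T.l D) :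
    T.l (T.hcomp (T.vid x) D h) = T.ver.id (T.hor.src x) :=
  (T.boxH.src_comp _ _ _).trans (T.l_vid x)

/-- The vertical inverse of a horizontal composition. -/
theorem inv_hcomp {A C : B} (h : T.r A = T.l C) (h' : T.r (T.boxV.inv A) = T.l (T.boxV.inv C)) :
    T.boxV.inv (T.hcomp A C h) = T.hcomp (T.boxV.inv A) (T.boxV.inv C) h' := by
  symm
  have hb : T.b (T.hcomp A C h) = T.t (T.hcomp (T.boxV.inv A) (T.boxV.inv C) h') := by
    rw [show T.b (T.hcomp A C h) = _ from T.b_hcomp _ _ _ (comp_tb h),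
      show T.t (T.hcomp _ _ h') = _ from T.t_hcomp _ _ _ (comp_tt h')]
    exact ArrowGroupoid.comp_congr (T.boxV.src_inv _).symm (T.boxV.src_inv _).symm _ _
  have hv : T.r (T.vid (T.t A)) = T.l (T.vid (T.t C)) := by
    rw [show T.r (T.vid _) = _ from T.r_vid _, show T.l (T.vid _) = _ from T.l_vid _, comp_tt h]
  have e1 := T.boxV.comp_inv A (T.boxV.src_inv A).symm
  have e2 := T.boxV.comp_inv C (T.boxV.src_inv C).symm
  refine ArrowGroupoid.eq_inv_of_comp hb ?_
  rw [T.interchange A C _ _ h h' (T.boxV.src_inv A).symm (T.boxV.src_inv C).symm hb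
    (by rw [e1, e2]; exact hv)]
  rw [ArrowGroupoid.comp_congr e1 e2 _ hv,
    show T.boxV.src (T.hcomp A C h) = _ from T.t_hcomp _ _ _ (comp_tt h)]
  exact (T.vid_comp _ _ _ _).symm

theorem l_inv (A : B) : T.l (T.boxV.inv A) = T.ver.inv (T.l A) := by
  have h : T.b A = T.t (T.boxV.inv A) := (T.boxV.src_inv A).symm
  refine ArrowGroupoid.eq_inv_of_comp (comp_ll h) ?_
  rw [← T.l_vcomp _ _ h (comp_ll h), T.boxV.comp_inv, T.l_vid, T.lt_eq_tl]

theorem r_inv (A : B) : T.r (T.boxV.inv A) = T.ver.inv (T.r A) := by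
  have h : T.b A = T.t (T.boxV.inv A) := (T.boxV.src_inv A).symm
  refine ArrowGroupoid.eq_inv_of_comp (comp_rr h) ?_
  rw [← T.r_vcomp _ _ h (comp_rr h), T.boxV.comp_inv, T.r_vid, T.rt_eq_tr]

theorem inv_ver_id (p : P) : T.ver.inv (T.ver.id p) = T.ver.id p := by
  have h : T.ver.tgt (T.ver.id p) = T.ver.src (T.ver.id p) := by rw [T.ver.tgt_id, T.ver.src_id]
  refine (ArrowGroupoid.eq_inv_of_comp h ?_).symm
  rw [ArrowGroupoid.id_comp', T.ver.src_id]

/-- The box `Θ_P` as an element of the core. -/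
theorem isCore_vid_id (p : P) : T.IsCore (T.vid (T.hor.id p)) :=
  ⟨⟨_, T.l_vid _⟩, ⟨p, T.boxV.tgt_id _⟩⟩

theorem core_hcomp_inv_isCore {D : B}
    (h : T.r (T.vid (T.hor.inv (T.t D))) = T.l D) :
    T.IsCore (T.boxV.inv (T.hcomp (T.vid (T.hor.inv (T.t D))) D h)) := by
  refine ⟨⟨T.hor.tgt (T.t D), ?_⟩, ⟨T.hor.tgt (T.t D), ?_⟩⟩
  · rw [l_inv, IsCore.l_vid_hcomp, T.hor.src_inv, inv_ver_id]
  · rw [show T.b (T.boxV.inv _) = _ from T.boxV.tgt_inv _,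
      show T.boxV.src _ = _ from IsCore.t_vid_hcomp h (T.hor.tgt_inv _), T.hor.inv_comp]

theorem vcomp_isCore {D L : B} (hL : T.IsCore L)
    (h : T.r (T.vid (T.t L)) = T.l D) (h' : T.b (T.hcomp (T.vid (T.t L)) D h) = T.t L) :
    T.IsCore (T.vcomp (T.hcomp (T.vid (T.t L)) D h) L h') := by
  refine ⟨⟨T.hor.src (T.t L), ?_⟩, ?_⟩
  · rw [show T.l (T.vcomp _ L h') = _ from T.l_vcomp _ _ _ (comp_ll h')]
    have e := IsCore.l_vid_hcomp h
    rw [ArrowGroupoid.comp_congr e hL.l_eq _ (by rw [T.ver.tgt_id, T.ver.src_id])]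
    exact ArrowGroupoid.comp_id' _
  · rw [show T.b (T.vcomp _ L h') = _ from T.boxV.tgt_comp _ _ _]
    exact hL.2

variable (T)

/-- The core groupoid `𝐃 ⇉ P`: source `s(D) = rt(D)`, target `e(D) = lt(D)`, identities `Θ_P`,
composition `D ⋄ L` equal to `id t(L) · D` on top of `L = L · id r(L)`, and inverse the vertical
inverse of `id t(D)⁻¹ · D`. -/
def core : ArrowGroupoid P T.Core where
  src D := T.hor.tgt (T.t D.1)
  tgt D := T.hor.src (T.t D.1)
  id p := ⟨T.vid (T.hor.id p), isCore_vid_id p⟩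
  comp D L h :=
    ⟨T.vcomp (T.hcomp (T.vid (T.t L.1)) D.1 (D.2.vid_comp h.symm)) L.1 (D.2.b_vid_hcomp _),
      vcomp_isCore L.2 _ _⟩
  inv D :=
    ⟨T.boxV.inv (T.hcomp (T.vid (T.hor.inv (T.t D.1))) D.1 (D.2.vid_comp (T.hor.tgt_inv _))),
      core_hcomp_inv_isCore _⟩
  src_id p := by
    rw [show T.t (T.vid _) = _ from T.boxV.src_id _, T.hor.tgt_id]
  tgt_id p := by
    rw [show T.t (T.vid _) = _ from T.boxV.src_id _, T.hor.src_id]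
  src_comp D L h := by
    rw [show T.t (T.vcomp _ _ _) = _ from T.boxV.src_comp _ _ _,
      show T.boxV.src _ = _ from IsCore.t_vid_hcomp _ h.symm, T.hor.tgt_comp]
  tgt_comp D L h := by
    rw [show T.t (T.vcomp _ _ _) = _ from T.boxV.src_comp _ _ _,
      show T.boxV.src _ = _ from IsCore.t_vid_hcomp _ h.symm, T.hor.src_comp]
  id_comp D h := by
    apply Subtype.ext
    have e : T.hcomp (T.vid (T.t D.1)) (T.vid (T.hor.id (T.hor.tgt (T.t D.1))))
        (((isCore_vid_id (T := T) _).vid_comp h.symm)) = T.vid (T.t D.1) := by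
      have hr : T.r (T.vid (T.t D.1)) = T.l (T.hid (T.ver.id (T.hor.tgt (T.t D.1)))) := by
        rw [show T.r _ = _ from T.r_vid _]; exact (T.boxH.src_id _).symm
      exact (ArrowGroupoid.comp_congr rfl (T.vid_id _) _ hr).trans (ArrowGroupoid.comp_id' _)
    exact (ArrowGroupoid.comp_congr e rfl _ (T.boxV.tgt_id _)).trans (ArrowGroupoid.id_comp' _)
  comp_id D h := by
    apply Subtype.ext
    have e₁ : T.vid (T.t (T.vid (T.hor.id (T.hor.src (T.t D.1))))) =
        T.hid (T.ver.id (T.hor.src (T.t D.1))) := by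
      rw [show T.t (T.vid _) = _ from T.boxV.src_id _]; exact T.vid_id _
    have hd : T.r (T.hid (T.ver.id (T.hor.src (T.t D.1)))) = T.l D.1 := by
      rw [D.2.l_eq]; exact T.boxH.tgt_id _
    have e : T.hcomp (T.vid (T.t (T.vid (T.hor.id (T.hor.src (T.t D.1)))))) D.1
        (D.2.vid_comp h.symm) = D.1 :=
      (ArrowGroupoid.comp_congr e₁ rfl _ hd).trans (ArrowGroupoid.id_comp' _)
    exact (ArrowGroupoid.comp_congr e rfl _ (by
      rw [show T.boxV.tgt D.1 = _ from D.2.b_eq]; exact (T.boxV.src_id _).symm)).trans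
      (ArrowGroupoid.comp_id' _)
  assoc D L M h₁ h₂ h₃ h₄ := by
    apply Subtype.ext
    have hML : T.hor.tgt (T.t M.1) = T.hor.src (T.t L.1) := h₂.symm
    have hLD : T.hor.tgt (T.t L.1) = T.hor.src (T.t D.1) := h₁.symm
    have c₁ : T.r (T.vid (T.t L.1)) = T.l D.1 := D.2.vid_comp hLD
    have c₂ : T.r (T.vid (T.t M.1)) = T.l L.1 := L.2.vid_comp hML
    have c₃ : T.r (T.vid (T.t M.1)) = T.l (T.vid (T.t L.1)) := by
      rw [show T.r _ = _ from T.r_vid _, show T.l _ = _ from T.l_vid _, hML]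
    have c₄ : T.r (T.vid (T.t M.1)) = T.l (T.hcomp (T.vid (T.t L.1)) D.1 c₁) := by
      rw [c₃]; exact (T.boxH.src_comp _ _ _).symm
    have v₁ : T.b (T.hcomp (T.vid (T.t L.1)) D.1 c₁) = T.t L.1 := D.2.b_vid_hcomp c₁
    have v₂ : T.b (T.hcomp (T.vid (T.t M.1)) L.1 c₂) = T.t M.1 := L.2.b_vid_hcomp c₂
    have v₀ : T.b (T.vid (T.t M.1)) = T.t (T.vid (T.t M.1)) :=
      (T.boxV.tgt_id _).trans (T.boxV.src_id _).symm
    have v₃ : T.b (T.hcomp (T.vid (T.t M.1)) (T.hcomp (T.vid (T.t L.1)) D.1 c₁) c₄) =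
        T.t (T.hcomp (T.vid (T.t M.1)) L.1 c₂) := by
      rw [show T.b (T.hcomp _ _ c₄) = _ from T.b_hcomp _ _ _ (comp_tb c₄),
        show T.t (T.hcomp _ _ c₂) = _ from T.t_hcomp _ _ _ (comp_tt c₂)]
      exact ArrowGroupoid.comp_congr v₀ v₁ _ _
    have c₅ : T.r (T.vcomp (T.vid (T.t M.1)) (T.vid (T.t M.1)) v₀) =
        T.l (T.vcomp (T.hcomp (T.vid (T.t L.1)) D.1 c₁) L.1 v₁) := by
      rw [show T.r _ = _ from T.r_vcomp _ _ _ (comp_rr v₀),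
        show T.l _ = _ from T.l_vcomp _ _ _ (comp_ll v₁)]
      exact ArrowGroupoid.comp_congr c₄ c₂ _ _
    have c₆ : T.r (T.vid (T.t M.1)) = T.l (T.vcomp (T.hcomp (T.vid (T.t L.1)) D.1 c₁) L.1 v₁) := by
      rw [← c₅]; exact congrArg T.r (ArrowGroupoid.id_comp' v₀).symm
    have e₁ : T.hcomp (T.vid (T.t M.1)) (T.vcomp (T.hcomp (T.vid (T.t L.1)) D.1 c₁) L.1 v₁) c₆ =
        T.vcomp (T.hcomp (T.vid (T.t M.1)) (T.hcomp (T.vid (T.t L.1)) D.1 c₁) c₄)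
          (T.hcomp (T.vid (T.t M.1)) L.1 c₂) v₃ :=
      (ArrowGroupoid.comp_congr (ArrowGroupoid.id_comp' v₀).symm rfl _ c₅).trans
        (T.interchange _ _ _ _ c₄ c₂ v₀ v₁ v₃ c₅).symm
    have eLM : T.t (T.vcomp (T.hcomp (T.vid (T.t M.1)) L.1 c₂) M.1 v₂) =
        T.hor.comp (T.t M.1) (T.t L.1) hML :=
      (T.boxV.src_comp _ _ _).trans (IsCore.t_vid_hcomp c₂ hML)
    have c₇ : T.r (T.hcomp (T.vid (T.t M.1)) (T.vid (T.t L.1)) c₃) = T.l D.1 := by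
      rw [← c₁]; exact T.boxH.tgt_comp _ _ _
    have c₈ : T.r (T.vid (T.t (T.vcomp (T.hcomp (T.vid (T.t M.1)) L.1 c₂) M.1 v₂))) = T.l D.1 := by
      rw [eLM, ← c₇]; exact congrArg T.r (T.vid_comp _ _ hML c₃)
    have e₂ : T.hcomp (T.vid (T.t (T.vcomp (T.hcomp (T.vid (T.t M.1)) L.1 c₂) M.1 v₂))) D.1 c₈ =
        T.hcomp (T.vid (T.t M.1)) (T.hcomp (T.vid (T.t L.1)) D.1 c₁) c₄ := by
      refine (ArrowGroupoid.comp_congr ((congrArg T.vid eLM).trans (T.vid_comp _ _ hML c₃))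
        rfl _ c₇).trans ?_
      exact T.boxH.assoc _ _ _ _ _ _ _
    have v₄ : T.b (T.vcomp (T.hcomp (T.vid (T.t M.1)) (T.hcomp (T.vid (T.t L.1)) D.1 c₁) c₄)
          (T.hcomp (T.vid (T.t M.1)) L.1 c₂) v₃) = T.t M.1 :=
      (T.boxV.tgt_comp _ _ _).trans v₂
    have v₅ : T.b (T.hcomp (T.vid (T.t M.1)) (T.hcomp (T.vid (T.t L.1)) D.1 c₁) c₄) =
        T.t (T.vcomp (T.hcomp (T.vid (T.t M.1)) L.1 c₂) M.1 v₂) := by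
      rw [v₃]; exact (T.boxV.src_comp _ _ _).symm
    refine (ArrowGroupoid.comp_congr (g := M.1) e₁ rfl _ v₄).trans ?_
    refine (T.boxV.assoc _ _ _ v₃ v₂ v₄ v₅).trans ?_
    exact ArrowGroupoid.comp_congr e₂.symm rfl _ _
  src_inv D := by
    rw [show T.t (T.boxV.inv _) = _ from T.boxV.src_inv _,
      show T.boxV.tgt _ = _ from D.2.b_vid_hcomp _, T.hor.tgt_inv]
  tgt_inv D := by
    rw [show T.t (T.boxV.inv _) = _ from T.boxV.src_inv _,
      show T.boxV.tgt _ = _ from D.2.b_vid_hcomp _, T.hor.src_inv]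
  comp_inv D h := by
    apply Subtype.ext
    have hi : T.r (T.vid (T.hor.inv (T.t D.1))) = T.l D.1 := D.2.vid_comp (T.hor.tgt_inv _)
    have ht : T.t (T.boxV.inv (T.hcomp (T.vid (T.hor.inv (T.t D.1))) D.1 hi)) =
        T.hor.inv (T.t D.1) :=
      (T.boxV.src_inv _).trans (D.2.b_vid_hcomp hi)
    refine (ArrowGroupoid.comp_congr (ArrowGroupoid.comp_congr (congrArg T.vid ht) rfl _ hi) rfl _
      (T.boxV.src_inv _).symm).trans ?_
    rw [T.boxV.comp_inv]
    refine congrArg T.vid ((IsCore.t_vid_hcomp hi (T.hor.tgt_inv _)).trans ?_)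
    exact T.hor.inv_comp _ _
  inv_comp D h := by
    apply Subtype.ext
    have hi : T.r (T.vid (T.hor.inv (T.t D.1))) = T.l D.1 := D.2.vid_comp (T.hor.tgt_inv _)
    have hx : T.r (T.vid (T.t D.1)) = T.l (T.vid (T.hor.inv (T.t D.1))) := by
      rw [show T.r _ = _ from T.r_vid _, show T.l _ = _ from T.l_vid _, T.hor.src_inv]
    have hxi : T.r (T.vid (T.t D.1)) =
        T.l (T.hcomp (T.vid (T.hor.inv (T.t D.1))) D.1 hi) := by
      rw [hx]; exact (T.boxH.src_comp _ _ _).symm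
    have hvi : T.boxV.inv (T.vid (T.t D.1)) = T.vid (T.t D.1) := by
      refine (ArrowGroupoid.eq_inv_of_comp
        ((T.boxV.tgt_id _).trans (T.boxV.src_id _).symm) ?_).symm
      refine (ArrowGroupoid.id_comp' _).trans ?_
      exact congrArg T.vid (T.boxV.src_id _).symm
    have hc : T.r (T.boxV.inv (T.vid (T.t D.1))) =
        T.l (T.boxV.inv (T.hcomp (T.vid (T.hor.inv (T.t D.1))) D.1 hi)) := by
      rw [r_inv, l_inv]; exact congrArg _ hxi
    have e₀ : T.hcomp (T.vid (T.t D.1)) (T.hcomp (T.vid (T.hor.inv (T.t D.1))) D.1 hi) hxi =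
        D.1 := by
      have hj : T.r (T.hcomp (T.vid (T.t D.1)) (T.vid (T.hor.inv (T.t D.1))) hx) = T.l D.1 := by
        rw [← hi]; exact T.boxH.tgt_comp _ _ _
      refine (T.boxH.assoc _ _ _ hx hi hj hxi).symm.trans ?_
      have e : T.hcomp (T.vid (T.t D.1)) (T.vid (T.hor.inv (T.t D.1))) hx =
          T.hid (T.ver.id (T.hor.src (T.t D.1))) := by
        refine (T.vid_comp _ _ (T.hor.src_inv _).symm hx).symm.trans ?_
        rw [T.hor.comp_inv]; exact T.vid_id _
      exact (ArrowGroupoid.comp_congr e rfl _ (by rw [← e]; exact hj)).trans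
        (ArrowGroupoid.id_comp' _)
    have e₁ : T.hcomp (T.vid (T.t D.1))
        (T.boxV.inv (T.hcomp (T.vid (T.hor.inv (T.t D.1))) D.1 hi))
        (by rw [← hc, hvi]) = T.boxV.inv D.1 := by
      refine (ArrowGroupoid.comp_congr hvi.symm rfl _ hc).trans ?_
      refine (inv_hcomp hxi hc).symm.trans ?_
      exact congrArg T.boxV.inv e₀
    refine (ArrowGroupoid.comp_congr e₁ rfl _ (T.boxV.tgt_inv _)).trans ?_
    rw [T.boxV.inv_comp]
    exact congrArg T.vid D.2.b_eq

end DoubleGroupoid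

/-! ## Weak bialgebras and weak Hopf algebras -/

section WeakHopf

open TensorProduct Coalgebra

variable (k H : Type*) [CommRing k] [Ring H] [Algebra k H] [Coalgebra k H]

/-- An algebra and coalgebra `H` is a weak bialgebra. -/
structure IsWeakBialgebra : Prop where
  /-- `Δ(xy) = Δ(x)Δ(y)` -/
  comul_mul : ∀ x y : H, comul (R := k) (x * y) = comul (R := k) x * comul (R := k) y
  /-- `Δ⁽²⁾(1) = (Δ(1) ⊗ 1)(1 ⊗ Δ(1))` -/
  comul_one : LinearMap.lTensor H (comul (R := k) (A := H)) (comul (R := k) (1 : H)) =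
    TensorProduct.assoc k H H H (comul (R := k) (1 : H) ⊗ₜ[k] (1 : H)) *
      ((1 : H) ⊗ₜ[k] comul (R := k) (1 : H))
  /-- `Δ⁽²⁾(1) = (1 ⊗ Δ(1))(Δ(1) ⊗ 1)` -/
  comul_one' : LinearMap.lTensor H (comul (R := k) (A := H)) (comul (R := k) (1 : H)) =
    ((1 : H) ⊗ₜ[k] comul (R := k) (1 : H)) *
      TensorProduct.assoc k H H H (comul (R := k) (1 : H) ⊗ₜ[k] (1 : H))
  /-- `ε(xyz) = ε(xy₁)ε(y₂z)` -/
  counit_mul : ∀ x y z : H, counit (R := k) (x * y * z) =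
    LinearMap.mul' k k (TensorProduct.map
      (counit (R := k) (A := H) ∘ₗ LinearMap.mulLeft k x)
      (counit (R := k) (A := H) ∘ₗ LinearMap.mulRight k z) (comul (R := k) y))
  /-- `ε(xyz) = ε(xy₂)ε(y₁z)` -/
  counit_mul' : ∀ x y z : H, counit (R := k) (x * y * z) =
    LinearMap.mul' k k (TensorProduct.map
      (counit (R := k) (A := H) ∘ₗ LinearMap.mulRight k z)
      (counit (R := k) (A := H) ∘ₗ LinearMap.mulLeft k x) (comul (R := k) y))

/-- The source map `ε_s(h) = (id ⊗ ε)((1 ⊗ h)Δ(1))`. Its range is the source subalgebra. -/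
noncomputable def sourceMap : H →ₗ[k] H :=
  (TensorProduct.rid k H).toLinearMap ∘ₗ LinearMap.lTensor H (counit (R := k) (A := H)) ∘ₗ
    LinearMap.mulRight k (comul (R := k) (1 : H)) ∘ₗ TensorProduct.mk k H H 1

/-- The target map `ε_t(h) = (ε ⊗ id)(Δ(1)(h ⊗ 1))`. Its range is the target subalgebra. -/
noncomputable def targetMap : H →ₗ[k] H :=
  (TensorProduct.lid k H).toLinearMap ∘ₗ LinearMap.rTensor H (counit (R := k) (A := H)) ∘ₗ
    LinearMap.mulLeft k (comul (R := k) (1 : H)) ∘ₗ (TensorProduct.mk k H H).flip 1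

variable {k H}

/-- `S` is an antipode of the weak bialgebra `H`. -/
structure IsWeakAntipode (S : H →ₗ[k] H) : Prop where
  /-- `m(id ⊗ S)Δ = ε_t` -/
  mul_lTensor : LinearMap.mul' k H ∘ₗ LinearMap.lTensor H S ∘ₗ comul = targetMap k H
  /-- `m(S ⊗ id)Δ = ε_s` -/
  mul_rTensor : LinearMap.mul' k H ∘ₗ LinearMap.rTensor H S ∘ₗ comul = sourceMap k H
  /-- `m⁽²⁾(S ⊗ id ⊗ S)Δ⁽²⁾ = S` -/
  mul_map_map : LinearMap.mul' k H ∘ₗ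
    TensorProduct.map S (LinearMap.mul' k H ∘ₗ LinearMap.lTensor H S) ∘ₗ
      LinearMap.lTensor H comul ∘ₗ comul = S

variable (k H)

/-- A weak Hopf algebra: a weak bialgebra with an antipode. -/
def IsWeakHopfAlgebra : Prop :=
  IsWeakBialgebra k H ∧ ∃ S : H →ₗ[k] H, IsWeakAntipode S

/-- A regular weak Hopf algebra: a weak Hopf algebra whose (unique) antipode `S` satisfies
`S² = id` on the source and on the target subalgebra. -/
def IsRegularWeakHopfAlgebra : Prop :=
  IsWeakBialgebra k H ∧ ∃ S : H →ₗ[k] H, IsWeakAntipode S ∧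
    (∀ x ∈ LinearMap.range (sourceMap k H), S (S x) = x) ∧
    (∀ x ∈ LinearMap.range (targetMap k H), S (S x) = x)

end WeakHopf

/-! ## The algebra and coalgebra spanned by the boxes -/

namespace DoubleGroupoid

variable {P H V B : Type*} (T : DoubleGroupoid P H V B)

/-- A function `B → kˣ` with `w(XY) = w(X)` for all horizontally composable `X`, `Y`; it defines
the horizontal cocycle `τ(X, Y) = w(Y)`. -/
structure Weight (k : Type*) [Field k] where
  toFun : B → kˣ
  map_hcomp : ∀ X Y (h : T.r X = T.l Y), toFun (T.hcomp X Y h) = toFun X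

/-- The weight `X ↦ ϑ(bl(X))` defined by a function `ϑ` on the vertices. -/
def vertexWeight {k : Type*} [Field k] (ϑ : P → kˣ) : T.Weight k where
  toFun X := ϑ (T.bl X)
  map_hcomp X Y h := congrArg (fun g => ϑ (T.ver.tgt g)) (T.boxH.src_comp X Y h)

open Classical in
/-- The normalization condition: for every vertical edge `g` and horizontal edge `x` with
`r(x) = t(g)`, the sum of `ϑ(bl(U))` over all boxes `U` with right edge `g` and top edge `x`
is `1`. -/
def IsNormalized [Fintype B] {k : Type*} [Field k] (ϑ : P → kˣ) : Prop :=
  ∀ (g : V) (x : H), T.hor.tgt x = T.ver.src g →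
    ∑ U : B with T.r U = g ∧ T.t U = x, (ϑ (T.bl U) : k) = 1

/-- The upper right corner function: the number of boxes with right edge `g` and top edge `x`. -/
noncomputable def urCorner (g : V) (x : H) : ℕ := Nat.card {U : B // T.r U = g ∧ T.t U = x}

/-- The filling condition: every pair of edges that can be the right and top edge of a box is the
right and top edge of some box. -/
def Filling : Prop := ∀ (g : V) (x : H), T.hor.tgt x = T.ver.src g → T.urCorner g x ≠ 0

variable {T} in
theorem urCorner_pos [Finite B] (X : B) : T.urCorner (T.r X) (T.t X) ≠ 0 := by
  have : Nonempty {U : B // T.r U = T.r X ∧ T.t U = T.t X} := ⟨⟨X, rfl, rfl⟩⟩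
  exact Nat.card_pos.ne'

variable {T} in
theorem urCorner_hcomp (X Y : B) (h : T.r X = T.l Y) :
    T.urCorner (T.r (T.hcomp X Y h)) (T.t (T.hcomp X Y h)) = T.urCorner (T.r X) (T.t X) := by
  have hr : T.r (T.hcomp X Y h) = T.r Y := T.boxH.tgt_comp _ _ _
  have ht : T.t (T.hcomp X Y h) = T.hor.comp (T.t X) (T.t Y) (comp_tt h) := T.t_hcomp _ _ _ _
  have hYi : T.r (T.boxH.inv Y) = T.l Y := T.boxH.tgt_inv Y
  have hiY : T.r Y = T.l (T.boxH.inv Y) := (T.boxH.src_inv Y).symm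
  have c₁ : ∀ U : B, T.r U = T.r X → T.r U = T.l Y := fun U hU => hU.trans h
  have c₂ : ∀ U : B, T.r U = T.r (T.hcomp X Y h) → T.r U = T.l (T.boxH.inv Y) :=
    fun U hU => (hU.trans hr).trans hiY
  have eX : T.hcomp (T.hcomp X Y h) (T.boxH.inv Y) (hr.trans hiY) = X := by
    refine (T.boxH.assoc _ _ _ h hiY _ (by rw [T.boxH.src_comp]; exact h)).trans ?_
    rw [ArrowGroupoid.comp_congr rfl (T.boxH.comp_inv Y hiY) _
      (by rw [T.boxH.src_id]; exact h)]
    exact ArrowGroupoid.comp_id' _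
  refine (Nat.card_congr ?_).symm
  refine
    { toFun := fun U => ⟨T.hcomp U.1 Y (c₁ U.1 U.2.1), ?_, ?_⟩
      invFun := fun U => ⟨T.hcomp U.1 (T.boxH.inv Y) (c₂ U.1 U.2.1), ?_, ?_⟩
      left_inv := ?_
      right_inv := ?_ }
  · exact (T.boxH.tgt_comp _ _ _).trans hr.symm
  · rw [ht, show T.t (T.hcomp U.1 Y _) = _ from T.t_hcomp _ _ _ (comp_tt (c₁ U.1 U.2.1))]
    exact ArrowGroupoid.comp_congr U.2.2 rfl _ _
  · exact (T.boxH.tgt_comp _ _ _).trans ((T.boxH.tgt_inv Y).trans h.symm)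
  · refine (T.t_hcomp _ _ _ (comp_tt (c₂ U.1 U.2.1))).trans ?_
    refine (ArrowGroupoid.comp_congr U.2.2 rfl _ (comp_tt (hr.trans hiY))).trans ?_
    exact (T.t_hcomp _ _ _ _).symm.trans (congrArg T.t eX)
  · rintro ⟨U, hU, hU'⟩
    apply Subtype.ext
    refine (T.boxH.assoc _ _ _ (c₁ U hU) hiY _ (by rw [T.boxH.src_comp]; exact c₁ U hU)).trans ?_
    rw [ArrowGroupoid.comp_congr rfl (T.boxH.comp_inv Y hiY) _
      (by rw [T.boxH.src_id]; exact c₁ U hU)]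
    exact ArrowGroupoid.comp_id' _
  · rintro ⟨U, hU, hU'⟩
    apply Subtype.ext
    refine (T.boxH.assoc _ _ _ (c₂ U hU) hYi _ (by rw [T.boxH.src_comp]; exact c₂ U hU)).trans ?_
    rw [ArrowGroupoid.comp_congr rfl (T.boxH.inv_comp Y hYi) _
      (by rw [T.boxH.src_id]; exact hU.trans hr)]
    exact ArrowGroupoid.comp_id' _

/-- The weight `X ↦ 1 / ⌝(X)`, where `⌝(X)` is the number of boxes with the same right and top
edges as `X`. -/
noncomputable def cornerWeight (k : Type*) [Field k] [CharZero k] [Finite B] : T.Weight k where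
  toFun X := (Units.mk0 (T.urCorner (T.r X) (T.t X) : k) (Nat.cast_ne_zero.2 (urCorner_pos X)))⁻¹
  map_hcomp X Y h := by
    congr 2
    rw [urCorner_hcomp X Y h]

/-- The vector space with basis the set of boxes; the weight `w` enters the coalgebra structure
below. -/
def BoxAlgebra {k : Type*} [Field k] {T : DoubleGroupoid P H V B} (_w : T.Weight k) : Type _ :=
  B →₀ k

namespace BoxAlgebra

variable {k : Type*} [Field k] {T} (w : T.Weight k)

noncomputable instance : AddCommGroup (BoxAlgebra w) := inferInstanceAs (AddCommGroup (B →₀ k))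

noncomputable instance : Module k (BoxAlgebra w) := inferInstanceAs (Module k (B →₀ k))

/-- A box as a basis vector. -/
noncomputable def single (A : B) : BoxAlgebra w := Finsupp.single A 1

/-- The linear map with prescribed values on the basis of boxes. -/
noncomputable def lift {M : Type*} [AddCommGroup M] [Module k M] (f : B → M) :
    BoxAlgebra w →ₗ[k] M := Finsupp.linearCombination k f

variable {w}

@[simp] theorem lift_single {M : Type*} [AddCommGroup M] [Module k M] (f : B → M) (A : B) :
    lift w f (single w A) = f A :=
  (Finsupp.linearCombination_single k (1 : k) A).trans (one_smul k _)

theorem hom_ext {M : Type*} [AddCommGroup M] [Module k M] {f g : BoxAlgebra w →ₗ[k] M}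
    (h : ∀ A, f (single w A) = g (single w A)) : f = g :=
  Finsupp.lhom_ext' fun A => LinearMap.ext_ring (h A)

variable (w)

open Classical in
/-- The product of two boxes: their vertical composition if it is defined, and zero otherwise. -/
noncomputable def boxMul (A C : B) : BoxAlgebra w :=
  if h : T.b A = T.t C then single w (T.vcomp A C h) else 0

/-- The multiplication as a bilinear map. -/
noncomputable def mulLin : BoxAlgebra w →ₗ[k] BoxAlgebra w →ₗ[k] BoxAlgebra w :=
  lift w fun A => lift w fun C => boxMul w A C

/-- The unit: the sum of all vertical identities. -/
noncomputable def unit [Fintype H] : BoxAlgebra w := ∑ x : H, single w (T.vid x)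

variable {w}

theorem mulLin_single (A C : B) : mulLin w (single w A) (single w C) = boxMul w A C := by
  simp [mulLin]

theorem boxMul_of_eq {A C : B} (h : T.b A = T.t C) :
    boxMul w A C = single w (T.vcomp A C h) := by
  simp [boxMul, h]

theorem boxMul_of_ne {A C : B} (h : T.b A ≠ T.t C) : boxMul w A C = 0 := by
  simp [boxMul, h]

theorem mulLin_assoc (x y z : BoxAlgebra w) :
    mulLin w (mulLin w x y) z = mulLin w x (mulLin w y z) := by
  suffices h : (LinearMap.llcomp k _ _ _ (mulLin w)) ∘ₗ (mulLin w) =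
      (LinearMap.llcomp k (BoxAlgebra w) _ _).flip (mulLin w) ∘ₗ
        (LinearMap.llcomp k (BoxAlgebra w) (BoxAlgebra w) _) ∘ₗ (mulLin w) from
    LinearMap.congr_fun (LinearMap.congr_fun (LinearMap.congr_fun h x) y) z
  refine hom_ext fun A => hom_ext fun C => hom_ext fun D => ?_
  change mulLin w (mulLin w (single w A) (single w C)) (single w D) =
    mulLin w (single w A) (mulLin w (single w C) (single w D))
  rw [mulLin_single, mulLin_single]
  by_cases h₁ : T.b A = T.t C
  · rw [boxMul_of_eq h₁, mulLin_single]
    have e₁ : T.b (T.vcomp A C h₁) = T.b C := T.boxV.tgt_comp _ _ _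
    by_cases h₂ : T.b C = T.t D
    · have e₂ : T.t (T.vcomp C D h₂) = T.t C := T.boxV.src_comp _ _ _
      rw [boxMul_of_eq h₂, mulLin_single, boxMul_of_eq (e₁.trans h₂),
        boxMul_of_eq (h₁.trans e₂.symm)]
      exact congrArg _ (T.boxV.assoc _ _ _ _ _ _ _)
    · rw [boxMul_of_ne h₂, boxMul_of_ne (by rw [e₁]; exact h₂), map_zero]
  · rw [boxMul_of_ne h₁, map_zero, LinearMap.zero_apply]
    by_cases h₂ : T.b C = T.t D
    · have e₂ : T.t (T.vcomp C D h₂) = T.t C := T.boxV.src_comp _ _ _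
      rw [boxMul_of_eq h₂, mulLin_single, boxMul_of_ne (by rw [e₂]; exact h₁)]
    · rw [boxMul_of_ne h₂, map_zero]

theorem unit_mulLin [Fintype H] (x : BoxAlgebra w) : mulLin w (unit w) x = x := by
  suffices h : mulLin w (unit w) = LinearMap.id from LinearMap.congr_fun h x
  refine hom_ext fun A => ?_
  rw [unit, map_sum, LinearMap.sum_apply, Finset.sum_eq_single (T.t A)]
  · have h : T.b (T.vid (T.t A)) = T.t A := T.boxV.tgt_id _
    rw [mulLin_single, boxMul_of_eq h]
    exact congrArg _ (ArrowGroupoid.id_comp' _)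
  · intro x _ hx
    rw [mulLin_single, boxMul_of_ne]
    rw [show T.b (T.vid x) = x from T.boxV.tgt_id _]
    exact hx
  · simp

theorem mulLin_unit [Fintype H] (x : BoxAlgebra w) : mulLin w x (unit w) = x := by
  suffices h : (mulLin w).flip (unit w) = LinearMap.id from LinearMap.congr_fun h x
  refine hom_ext fun A => ?_
  rw [LinearMap.flip_apply, unit, map_sum, Finset.sum_eq_single (T.b A)]
  · have h : T.b A = T.t (T.vid (T.b A)) := (T.boxV.src_id _).symm
    rw [mulLin_single, boxMul_of_eq h]
    exact congrArg _ (ArrowGroupoid.comp_id' _)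
  · intro x _ hx
    rw [mulLin_single, boxMul_of_ne]
    rw [show T.t (T.vid x) = x from T.boxV.src_id _]
    exact hx.symm
  · simp

/-- The groupoid algebra of the vertical composition. -/
noncomputable instance [Fintype H] : Ring (BoxAlgebra w) :=
  { (inferInstance : AddCommGroup (BoxAlgebra w)) with
    mul := fun x y => mulLin w x y
    one := unit w
    mul_assoc := mulLin_assoc
    one_mul := unit_mulLin
    mul_one := mulLin_unit
    left_distrib := fun x y z => map_add (mulLin w x) y z
    right_distrib := fun x y z => by
      change mulLin w (x + y) z = mulLin w x z + mulLin w y z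
      rw [map_add, LinearMap.add_apply]
    zero_mul := fun x => by
      change mulLin w 0 x = 0
      rw [map_zero, LinearMap.zero_apply]
    mul_zero := fun x => map_zero (mulLin w x) }

noncomputable instance [Fintype H] : Algebra k (BoxAlgebra w) :=
  Algebra.ofModule
    (fun c x y => by
      change mulLin w (c • x) y = c • mulLin w x y
      rw [map_smul, LinearMap.smul_apply])
    (fun c x y => map_smul (mulLin w x) c y)

open Classical in
/-- The pairs `(X, Y)` with `XY = A`. -/
noncomputable def factorizations (T : DoubleGroupoid P H V B) [Fintype B] (A : B) :
    Finset (B × B) :=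
  Finset.univ.filter fun p => ∃ h : T.r p.1 = T.l p.2, T.hcomp p.1 p.2 h = A

theorem mem_factorizations [Fintype B] {A : B} {p : B × B} :
    p ∈ factorizations T A ↔ ∃ h : T.r p.1 = T.l p.2, T.hcomp p.1 p.2 h = A := by
  simp [factorizations]

open Classical in
/-- `Δ(A) = ∑_{XY = A} w(Y) X ⊗ Y` and `ε(A) = w(A)⁻¹` if `A` is a horizontal identity, and
`ε(A) = 0` otherwise. -/
noncomputable instance [Fintype B] : CoalgebraStruct k (BoxAlgebra w) where
  comul := lift w fun A => ∑ p ∈ factorizations T A,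
    (w.toFun p.2 : k) • (single w p.1 ⊗ₜ[k] single w p.2)
  counit := lift w fun A => if T.boxH.IsId A then (((w.toFun A)⁻¹ : kˣ) : k) else 0

theorem comul_single [Fintype B] (A : B) :
    CoalgebraStruct.comul (R := k) (single w A) = ∑ p ∈ factorizations T A,
      (w.toFun p.2 : k) • (single w p.1 ⊗ₜ[k] single w p.2) :=
  lift_single _ _

open Classical in
theorem counit_single [Fintype B] (A : B) :
    CoalgebraStruct.counit (R := k) (single w A) =
      if T.boxH.IsId A then (((w.toFun A)⁻¹ : kˣ) : k) else 0 :=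
  lift_single _ _

/-- The coalgebra dual to the horizontal composition, deformed by the weight `w`. -/
noncomputable instance [Fintype B] : Coalgebra k (BoxAlgebra w) where
  coassoc := by
    refine hom_ext fun A => ?_
    simp only [LinearMap.comp_apply, LinearEquiv.coe_coe, comul_single, map_sum, map_smul,
      LinearMap.rTensor_tmul, LinearMap.lTensor_tmul, TensorProduct.sum_tmul,
      TensorProduct.tmul_sum, ← TensorProduct.smul_tmul', TensorProduct.tmul_smul,
      TensorProduct.assoc_tmul, Finset.smul_sum, smul_smul]
    rw [Finset.sum_sigma', Finset.sum_sigma']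
    have key₁ : ∀ a : (_ : B × B) × B × B,
        a ∈ (factorizations T A).sigma (fun p => factorizations T p.1) →
        T.r a.2.2 = T.l a.1.2 := by
      intro a ha
      obtain ⟨h₁, h₂⟩ := Finset.mem_sigma.1 ha
      obtain ⟨e₁, -⟩ := mem_factorizations.1 h₁
      obtain ⟨e₂, f₂⟩ := mem_factorizations.1 h₂
      rw [← e₁, ← f₂]; exact (T.boxH.tgt_comp _ _ _).symm
    have key₂ : ∀ a : (_ : B × B) × B × B,
        a ∈ (factorizations T A).sigma (fun p => factorizations T p.2) →
        T.r a.1.1 = T.l a.2.1 := by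
      intro a ha
      obtain ⟨h₁, h₂⟩ := Finset.mem_sigma.1 ha
      obtain ⟨e₁, -⟩ := mem_factorizations.1 h₁
      obtain ⟨e₂, f₂⟩ := mem_factorizations.1 h₂
      rw [e₁, ← f₂]; exact T.boxH.src_comp _ _ _
    refine Finset.sum_bij'
      (fun a ha => ⟨(a.2.1, T.hcomp a.2.2 a.1.2 (key₁ a ha)), (a.2.2, a.1.2)⟩)
      (fun a ha => ⟨(T.hcomp a.1.1 a.2.1 (key₂ a ha), a.2.2), (a.1.1, a.2.1)⟩) ?_ ?_ ?_ ?_ ?_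
    · intro a ha
      obtain ⟨h₁, h₂⟩ := Finset.mem_sigma.1 ha
      obtain ⟨e₁, f₁⟩ := mem_factorizations.1 h₁
      obtain ⟨e₂, f₂⟩ := mem_factorizations.1 h₂
      have e : T.r a.2.1 = T.l (T.hcomp a.2.2 a.1.2 (key₁ a ha)) :=
        e₂.trans (T.boxH.src_comp _ _ _).symm
      refine Finset.mem_sigma.2 ⟨mem_factorizations.2 ⟨e, ?_⟩, mem_factorizations.2 ⟨_, rfl⟩⟩
      have e' : T.r (T.hcomp a.2.1 a.2.2 e₂) = T.l a.1.2 :=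
        (T.boxH.tgt_comp _ _ _).trans (key₁ a ha)
      refine (T.boxH.assoc _ _ _ e₂ (key₁ a ha) e' e).symm.trans ?_
      exact (ArrowGroupoid.comp_congr f₂ rfl _ e₁).trans f₁
    · intro a ha
      obtain ⟨h₁, h₂⟩ := Finset.mem_sigma.1 ha
      obtain ⟨e₁, f₁⟩ := mem_factorizations.1 h₁
      obtain ⟨e₂, f₂⟩ := mem_factorizations.1 h₂
      have e : T.r (T.hcomp a.1.1 a.2.1 (key₂ a ha)) = T.l a.2.2 :=
        (T.boxH.tgt_comp _ _ _).trans e₂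
      refine Finset.mem_sigma.2 ⟨mem_factorizations.2 ⟨e, ?_⟩, mem_factorizations.2 ⟨_, rfl⟩⟩
      have e' : T.r a.1.1 = T.l (T.hcomp a.2.1 a.2.2 e₂) :=
        (key₂ a ha).trans (T.boxH.src_comp _ _ _).symm
      refine (T.boxH.assoc _ _ _ (key₂ a ha) e₂ e e').trans ?_
      exact (ArrowGroupoid.comp_congr rfl f₂ _ e₁).trans f₁
    · rintro ⟨⟨X, Y⟩, U, W⟩ ha
      obtain ⟨h₁, h₂⟩ := Finset.mem_sigma.1 ha
      obtain ⟨e₂, f₂⟩ := mem_factorizations.1 h₂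
      exact Sigma.ext (Prod.ext f₂ rfl) HEq.rfl
    · rintro ⟨⟨X, Y⟩, U, W⟩ ha
      obtain ⟨h₁, h₂⟩ := Finset.mem_sigma.1 ha
      obtain ⟨e₂, f₂⟩ := mem_factorizations.1 h₂
      exact Sigma.ext (Prod.ext rfl f₂) HEq.rfl
    · intro a ha
      dsimp only
      rw [w.map_hcomp _ _ (key₁ a ha), mul_comm]
  rTensor_counit_comp_comul := by
    refine hom_ext fun A => ?_
    have hA : T.r (T.hid (T.l A)) = T.l A := T.boxH.tgt_id _
    have eA : T.hcomp (T.hid (T.l A)) A hA = A := ArrowGroupoid.id_comp' _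
    simp only [LinearMap.comp_apply, comul_single, map_sum, map_smul, LinearMap.rTensor_tmul,
      counit_single]
    rw [Finset.sum_eq_single (T.hid (T.l A), A)]
    · rw [if_pos ⟨_, rfl⟩, TensorProduct.smul_tmul']
      rw [← w.map_hcomp _ _ hA, eA]
      simp
    · rintro ⟨X, Y⟩ hp hne
      obtain ⟨e, f⟩ := mem_factorizations.1 hp
      dsimp only at e f ⊢
      rw [if_neg, TensorProduct.zero_tmul, smul_zero]
      rintro ⟨g, rfl⟩
      have hY : Y = A := (ArrowGroupoid.id_comp' e).symm.trans f
      subst hY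
      exact hne (Prod.ext (congrArg T.hid ((T.boxH.tgt_id g).symm.trans e)) rfl)
    · intro hn
      exact absurd (mem_factorizations.2 ⟨hA, eA⟩) hn
  lTensor_counit_comp_comul := by
    refine hom_ext fun A => ?_
    have hA : T.r A = T.l (T.hid (T.r A)) := (T.boxH.src_id _).symm
    have eA : T.hcomp A (T.hid (T.r A)) hA = A := ArrowGroupoid.comp_id' _
    simp only [LinearMap.comp_apply, comul_single, map_sum, map_smul, LinearMap.lTensor_tmul,
      counit_single]
    rw [Finset.sum_eq_single (A, T.hid (T.r A))]
    · rw [if_pos ⟨_, rfl⟩, ← TensorProduct.tmul_smul]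
      simp
    · rintro ⟨X, Y⟩ hp hne
      obtain ⟨e, f⟩ := mem_factorizations.1 hp
      dsimp only at e f ⊢
      rw [if_neg, TensorProduct.tmul_zero, smul_zero]
      rintro ⟨g, rfl⟩
      have hX : X = A := (ArrowGroupoid.comp_id' e).symm.trans f
      subst hX
      exact hne (Prod.ext rfl (congrArg T.hid ((T.boxH.src_id g).symm.trans e.symm)))
    · intro hn
      exact absurd (mem_factorizations.2 ⟨hA, eA⟩) hn

end BoxAlgebra

end DoubleGroupoid

/-!
The weak bialgebra `BoxAlgebra (T.vertexWeight ϑ)` is studied on its basis of boxes. Every axiom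
becomes an equality of two weighted sums over configurations of boxes, proved by matching the
configurations.

*Weak bialgebra.* For multiplicativity of `Δ`, fix a factorization `RS = A / C`. The pairs of
factorizations `A = XY`, `C = ZW` with `R = X / Z` and `S = Y / W` are parametrized by the box `Y`,
which may be any box with the right edge of `A` and the top edge of `S`
(`exists_factorizations_of_vComp`); the weights `ϑ(bl(Y))` of these boxes add up to `1` by the
normalization condition. The two formulas for `Δ⁽²⁾(1)` hold without normalization: if `XYZ` is a
vertical identity then `Y` splits uniquely as `U / W`, and uniquely as `W / U`, with `XU` and `WZ`
vertical identities (`IsUnitTriple.exists_split`, `IsUnitPair.isUnitTriple` and their primed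
versions). The two formulas for `ε(xyz)` follow from the same facts in the transposed double
groupoid.

*Antipode.* Let `A⁻¹` be the inverse of `A` in both directions, and `tr`, `br` the right vertices
of a box. The antipode is `S(A) = ϑ(tr(A)) / ϑ(br(A)) A⁻¹`. The target map sends `A` to a multiple
of the sum of the boxes `Y / Z⁻¹` with `YZ = A`, each of which arises from several factorizations
whose weights add up to `1` by normalization (`HComp.exists_isTargetTerm`,
`mul_lTensor_antipode`). The source map is treated in the same way with the boxes `Y⁻¹ / Z`.
The axiom `S * id * S = S` is `S * ε_t = S`, where for each `A = XY` at most one box in `ε_t(Y)` can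
be placed below `X⁻¹` (`HComp.exists_inv_vComp`).

*Regularity.* `S²` multiplies a box by
`ϑ(tr) ϑ(bl) / (ϑ(br) ϑ(tl))`. The source and target maps take values in the span of the boxes
with identity left, respectively right, edge. Such a box is a core box, or the inverse of one, up to
horizontal composition with a vertical identity, so the scalar is `1` if `ϑ` is constant on the
components of the core. Conversely every core box `D` occurs in `ε_s(D⁻¹)`, and its scalar compares
`ϑ` at the ends of `D`. Uniqueness of the antipode (`IsWeakAntipode.unique`) makes this independent
of the choice of `S`.

*Corner weight.* The number of boxes with a given top and right edge depends only on the bottom left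
vertex `p` of such a box, and is the number of core arrows with target `p`
(`urCorner_eq`, `urCorner_id_eq_card_core`). Hence the corner weight is a normalized vertex weight,
constant on the components of the core, and the second statement is a case of the first.
-/

/-! ### Composition in a groupoid as a relation -/

namespace ArrowGroupoid

variable {O A : Type*} {G : ArrowGroupoid O A}

variable (G) in
/-- `f` and `g` are composable and their composite is `k`. Expressing composition as a relation
avoids carrying composability proofs inside terms. -/
def IsComp (f g k : A) : Prop := ∃ e : G.tgt f = G.src g, G.comp f g e = k

theorem isComp_comp {f g : A} (e : G.tgt f = G.src g) : G.IsComp f g (G.comp f g e) := ⟨e, rfl⟩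

theorem exists_isComp {f g : A} (e : G.tgt f = G.src g) : ∃ k, G.IsComp f g k := ⟨_, e, rfl⟩

namespace IsComp

variable {f f' g g' h k k' x y z : A}

theorem src (hk : G.IsComp f g k) : G.src k = G.src f := by
  obtain ⟨e, rfl⟩ := hk; exact G.src_comp _ _ _

theorem tgt (hk : G.IsComp f g k) : G.tgt k = G.tgt g := by
  obtain ⟨e, rfl⟩ := hk; exact G.tgt_comp _ _ _

theorem tgt_eq_src (hk : G.IsComp f g k) : G.tgt f = G.src g := hk.1

theorem unique (hk : G.IsComp f g k) (hk' : G.IsComp f g k') : k = k' := by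
  obtain ⟨e, rfl⟩ := hk; obtain ⟨e', rfl⟩ := hk'; rfl

/-- If `x = fg`, `y = gh` and `z = xh`, then `z = fy`. -/
theorem assoc (hx : G.IsComp f g x) (hy : G.IsComp g h y) (hz : G.IsComp x h z) :
    G.IsComp f y z := by
  obtain ⟨ex, rfl⟩ := hx; obtain ⟨ey, rfl⟩ := hy; obtain ⟨ez, rfl⟩ := hz
  exact ⟨by rw [G.src_comp]; exact ex, (G.assoc _ _ _ _ _ _ _).symm⟩

/-- If `x = fg`, `y = gh` and `z = fy`, then `z = xh`. -/
theorem assoc_symm (hx : G.IsComp f g x) (hy : G.IsComp g h y) (hz : G.IsComp f y z) :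
    G.IsComp x h z := by
  obtain ⟨ex, rfl⟩ := hx; obtain ⟨ey, rfl⟩ := hy; obtain ⟨ez, rfl⟩ := hz
  exact ⟨by rw [G.tgt_comp]; exact ey, G.assoc _ _ _ _ _ _ _⟩

theorem id_left {p : O} (hp : p = G.src f) : G.IsComp (G.id p) f f :=
  ⟨by rw [G.tgt_id, hp], id_comp' _⟩

theorem id_right {p : O} (hp : p = G.tgt f) : G.IsComp f (G.id p) f :=
  ⟨by rw [G.src_id, hp], comp_id' _⟩

theorem eq_of_id_left {p : O} (hk : G.IsComp (G.id p) f k) : k = f := by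
  obtain ⟨e, rfl⟩ := hk; exact id_comp' _

theorem eq_of_id_right {p : O} (hk : G.IsComp f (G.id p) k) : k = f := by
  obtain ⟨e, rfl⟩ := hk; exact comp_id' _

theorem self_inv (f : A) : G.IsComp f (G.inv f) (G.id (G.src f)) :=
  ⟨(G.src_inv f).symm, G.comp_inv _ _⟩

theorem inv_self (f : A) : G.IsComp (G.inv f) f (G.id (G.tgt f)) :=
  ⟨G.tgt_inv f, G.inv_comp _ _⟩

/-- If `k = fg`, then `g = f⁻¹k`. -/
theorem inv_left (hk : G.IsComp f g k) : G.IsComp (G.inv f) k g :=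
  (inv_self f).assoc hk (id_left hk.tgt_eq_src)

/-- If `k = fg`, then `f = kg⁻¹`. -/
theorem inv_right (hk : G.IsComp f g k) : G.IsComp k (G.inv g) f :=
  hk.assoc_symm (self_inv g) (id_right hk.tgt_eq_src.symm)

theorem left_cancel (hk : G.IsComp f g k) (hk' : G.IsComp f g' k) : g = g' :=
  hk.inv_left.unique hk'.inv_left

theorem right_cancel (hk : G.IsComp f g k) (hk' : G.IsComp f' g k) : f = f' :=
  hk.inv_right.unique hk'.inv_right

end IsComp

theorem inv_inv (f : A) : G.inv (G.inv f) = f :=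
  (IsComp.inv_self (G.inv f)).right_cancel
    (by rw [G.tgt_inv]; exact IsComp.self_inv f)

theorem inv_id (p : O) : G.inv (G.id p) = G.id p := by
  have h := IsComp.eq_of_id_left (IsComp.self_inv (G := G) (G.id p))
  rw [← h, G.src_id]

theorem exists_isComp_left {f k : A} (h : G.src f = G.src k) : ∃ g, G.IsComp f g k := by
  obtain ⟨g, hg⟩ := exists_isComp (G := G) (f := G.inv f) (g := k) (by rw [G.tgt_inv, h])
  exact ⟨g, inv_inv (G := G) f ▸ hg.inv_left⟩

theorem exists_isComp_right {g k : A} (h : G.tgt g = G.tgt k) : ∃ f, G.IsComp f g k := by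
  obtain ⟨f, hf⟩ := exists_isComp (G := G) (f := k) (g := G.inv g) (by rw [G.src_inv, h])
  exact ⟨f, inv_inv (G := G) g ▸ hf.inv_right⟩

theorem id_injective {p q : O} (h : G.id p = G.id q) : p = q := by
  rw [← G.src_id p, h, G.src_id]

end ArrowGroupoid

/-! ### Composition of boxes as a relation -/

namespace DoubleGroupoid

open ArrowGroupoid

variable {P H V B : Type*} (T : DoubleGroupoid P H V B)

/-- `E` is the horizontal composition of `A` and `C`. -/
abbrev HComp (A C E : B) : Prop := T.boxH.IsComp A C E

/-- `E` is the vertical composition of `A` (on top) and `C`. -/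
abbrev VComp (A C E : B) : Prop := T.boxV.IsComp A C E

/-- The double groupoid obtained by exchanging the horizontal and the vertical direction. -/
abbrev transpose : DoubleGroupoid P V H B where
  hor := T.ver
  ver := T.hor
  boxV := T.boxH
  boxH := T.boxV
  lt_eq_tl A := (T.lt_eq_tl A).symm
  rt_eq_tr A := (T.lb_eq_bl A).symm
  lb_eq_bl A := (T.rt_eq_tr A).symm
  rb_eq_br A := (T.rb_eq_br A).symm
  t_hcomp := T.l_vcomp
  b_hcomp := T.r_vcomp
  l_vcomp := T.t_hcomp
  r_vcomp := T.b_hcomp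
  l_vid := T.t_hid
  r_vid := T.b_hid
  t_hid := T.l_vid
  b_hid := T.r_vid
  vid_comp := T.hid_comp
  hid_comp := T.vid_comp
  vid_id p := (T.vid_id p).symm
  interchange A B C D h₁ h₂ h₃ h₄ h h' := (T.interchange A C B D h₃ h₄ h₁ h₂ h' h).symm

variable {T} {A C E D F I J : B}

namespace HComp

theorem l (h : T.HComp A C E) : T.l E = T.l A := h.src
theorem r (h : T.HComp A C E) : T.r E = T.r C := h.tgt
theorem r_eq_l (h : T.HComp A C E) : T.r A = T.l C := h.1

theorem t (h : T.HComp A C E) : T.hor.IsComp (T.t A) (T.t C) (T.t E) := by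
  obtain ⟨e, rfl⟩ := h; exact ⟨comp_tt e, (T.t_hcomp _ _ _ _).symm⟩

theorem b (h : T.HComp A C E) : T.hor.IsComp (T.b A) (T.b C) (T.b E) := by
  obtain ⟨e, rfl⟩ := h; exact ⟨comp_tb e, (T.b_hcomp _ _ _ _).symm⟩

end HComp

namespace VComp

theorem t (h : T.VComp A C E) : T.t E = T.t A := h.src
theorem b (h : T.VComp A C E) : T.b E = T.b C := h.tgt
theorem b_eq_t (h : T.VComp A C E) : T.b A = T.t C := h.1
theorem l (h : T.VComp A C E) : T.ver.IsComp (T.l A) (T.l C) (T.l E) := HComp.t (T := T.transpose) h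
theorem r (h : T.VComp A C E) : T.ver.IsComp (T.r A) (T.r C) (T.r E) := HComp.b (T := T.transpose) h

end VComp

/-- The interchange law: if the rows `AC = E`, `DF = I` and the columns `A / D = J`, `C / F = K`
exist, then so do `E / I` and `JK`, and they agree. -/
theorem HComp.interchange {K : B} (h₁ : T.HComp A C E) (h₂ : T.HComp D F I) (h₃ : T.VComp A D J)
    (h₄ : T.VComp C F K) : ∃ L, T.VComp E I L ∧ T.HComp J K L := by
  obtain ⟨e₁, rfl⟩ := h₁
  obtain ⟨e₂, rfl⟩ := h₂
  obtain ⟨e₃, rfl⟩ := h₃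
  obtain ⟨e₄, rfl⟩ := h₄
  have h : T.boxV.tgt (T.boxH.comp A C e₁) = T.boxV.src (T.boxH.comp D F e₂) := by
    rw [T.b_hcomp _ _ _ (comp_tb e₁), T.t_hcomp _ _ _ (comp_tt e₂)]
    exact comp_congr e₃ e₄ _ _
  have h' : T.boxH.tgt (T.boxV.comp A D e₃) = T.boxH.src (T.boxV.comp C F e₄) := by
    rw [T.r_vcomp _ _ _ (comp_rr e₃), T.l_vcomp _ _ _ (comp_ll e₄)]
    exact comp_congr e₁ e₂ _ _
  exact ⟨_, ⟨h, rfl⟩, ⟨h', (T.interchange A C D F e₁ e₂ e₃ e₄ h h').symm⟩⟩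

theorem exists_hComp (h : T.r A = T.l C) : ∃ E, T.HComp A C E := exists_isComp h
theorem exists_vComp (h : T.b A = T.t C) : ∃ E, T.VComp A C E := exists_isComp h
theorem exists_hComp_left (h : T.l A = T.l E) : ∃ C, T.HComp A C E := exists_isComp_left h
theorem exists_vComp_left (h : T.t A = T.t E) : ∃ C, T.VComp A C E := exists_isComp_left h
theorem exists_hComp_right (h : T.r C = T.r E) : ∃ A, T.HComp A C E := exists_isComp_right h
theorem exists_vComp_right (h : T.b C = T.b E) : ∃ A, T.VComp A C E := exists_isComp_right h

theorem t_vid (x : H) : T.t (T.vid x) = x := T.boxV.src_id x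
theorem b_vid (x : H) : T.b (T.vid x) = x := T.boxV.tgt_id x
theorem l_hid (g : V) : T.l (T.hid g) = g := T.boxH.src_id g
theorem r_hid (g : V) : T.r (T.hid g) = g := T.boxH.tgt_id g

theorem hComp_vid {x y z : H} (h : T.hor.IsComp x y z) :
    T.HComp (T.vid x) (T.vid y) (T.vid z) := by
  obtain ⟨e, rfl⟩ := h
  have h' : T.r (T.vid x) = T.l (T.vid y) := by
    refine (T.r_vid x).trans (Eq.trans ?_ (T.l_vid y).symm)
    rw [e]
  exact ⟨h', (T.vid_comp _ _ _ _).symm⟩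

theorem vComp_vid_left {x : H} (h : x = T.t A) : T.VComp (T.vid x) A A := IsComp.id_left h
theorem vComp_vid_right {x : H} (h : x = T.b A) : T.VComp A (T.vid x) A := IsComp.id_right h
theorem hComp_hid_left {g : V} (h : g = T.l A) : T.HComp (T.hid g) A A := IsComp.id_left h
theorem hComp_hid_right {g : V} (h : g = T.r A) : T.HComp A (T.hid g) A := IsComp.id_right h

variable (T) in
/-- The vertical inverse of a box. -/
abbrev vinv (A : B) : B := T.boxV.inv A

variable (T) in
/-- The horizontal inverse of a box. -/
abbrev hinv (A : B) : B := T.boxH.inv A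

variable (T) in
/-- The inverse of a box in both directions. -/
abbrev inv (A : B) : B := T.hinv (T.vinv A)

theorem HComp.vinv (h : T.HComp A C E) : T.HComp (T.vinv A) (T.vinv C) (T.vinv E) := by
  obtain ⟨e, rfl⟩ := h
  have h' : T.r (T.boxV.inv A) = T.l (T.boxV.inv C) := by rw [r_inv, l_inv]; exact congrArg _ e
  exact ⟨h', (inv_hcomp e h').symm⟩

theorem t_vinv (A : B) : T.t (T.vinv A) = T.b A := T.boxV.src_inv A
theorem b_vinv (A : B) : T.b (T.vinv A) = T.t A := T.boxV.tgt_inv A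
theorem l_vinv (A : B) : T.l (T.vinv A) = T.ver.inv (T.l A) := l_inv A
theorem r_vinv (A : B) : T.r (T.vinv A) = T.ver.inv (T.r A) := r_inv A
theorem l_hinv (A : B) : T.l (T.hinv A) = T.r A := T.boxH.src_inv A
theorem r_hinv (A : B) : T.r (T.hinv A) = T.l A := T.boxH.tgt_inv A
theorem t_hinv (A : B) : T.t (T.hinv A) = T.hor.inv (T.t A) := l_inv (T := T.transpose) A
theorem b_hinv (A : B) : T.b (T.hinv A) = T.hor.inv (T.b A) := r_inv (T := T.transpose) A

theorem vinv_hid (g : V) : T.vinv (T.hid g) = T.hid (T.ver.inv g) := by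
  have h : T.HComp (T.hid (T.ver.inv g)) (T.vinv (T.hid g)) (T.vinv (T.hid g)) :=
    
    IsComp.id_left ((congrArg T.ver.inv (l_hid g)).symm.trans (l_vinv _).symm)
  have h' : T.HComp (T.hid g) (T.hid g) (T.hid g) := IsComp.id_left (l_hid g).symm
  have h'' := (h'.vinv).right_cancel h
  exact h''

theorem vinv_hinv (A : B) : T.vinv (T.hinv A) = T.inv A := by
  have h : T.HComp A (T.hinv A) (T.hid (T.l A)) := IsComp.self_inv A
  have h₁ := HComp.vinv h
  rw [vinv_hid, ← l_vinv] at h₁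
  exact h₁.left_cancel (IsComp.self_inv _)

theorem inv_inv (A : B) : T.inv (T.inv A) = A := by
  change T.hinv (T.vinv (T.hinv (T.vinv A))) = A
  rw [vinv_hinv]
  change T.hinv (T.hinv (T.vinv (T.vinv A))) = A
  rw [show T.hinv (T.hinv _) = _ from ArrowGroupoid.inv_inv _,
    show T.vinv (T.vinv _) = _ from ArrowGroupoid.inv_inv _]

theorem t_inv (A : B) : T.t (T.inv A) = T.hor.inv (T.b A) := by rw [t_hinv, t_vinv]
theorem b_inv (A : B) : T.b (T.inv A) = T.hor.inv (T.t A) := by rw [b_hinv, b_vinv]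
theorem l_inv' (A : B) : T.l (T.inv A) = T.ver.inv (T.r A) := by rw [l_hinv, r_vinv]
theorem r_inv' (A : B) : T.r (T.inv A) = T.ver.inv (T.l A) := by rw [r_hinv, l_vinv]

end DoubleGroupoid

/-! ### Factorizations of identity boxes -/

namespace DoubleGroupoid

open ArrowGroupoid

variable {P H V B : Type*} {T : DoubleGroupoid P H V B} {X Y Z U W A : B}

variable (T) in
/-- The horizontal composition of `X` and `Y` is a vertical identity: these are the pairs that
occur in the comultiplication of the unit. -/
def IsUnitPair (X Y : B) : Prop := ∃ x, T.HComp X Y (T.vid x)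

variable (T) in
/-- The vertical composition of `A` and `C` is a horizontal identity: these are the pairs whose
product has nonzero counit. -/
def IsCounitPair (A C : B) : Prop := ∃ g, T.VComp A C (T.hid g)

namespace IsUnitPair

theorem hComp_t (h : T.IsUnitPair X Y) {x : H} (hx : T.hor.IsComp (T.t X) (T.t Y) x) :
    T.HComp X Y (T.vid x) := by
  obtain ⟨y, h⟩ := h
  rwa [hx.unique (h.t), t_vid]

theorem hComp_b (h : T.IsUnitPair X Y) {x : H} (hx : T.hor.IsComp (T.b X) (T.b Y) x) :
    T.HComp X Y (T.vid x) := by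
  obtain ⟨y, h⟩ := h
  rwa [hx.unique (h.b), b_vid]

theorem l (h : T.IsUnitPair X Y) : T.l X = T.ver.id (T.hor.src (T.t X)) := by
  obtain ⟨x, h⟩ := h
  have e := h.t.src
  rw [t_vid] at e
  rw [← e]
  exact h.l.symm.trans (T.l_vid x)

theorem r (h : T.IsUnitPair X Y) : T.r Y = T.ver.id (T.hor.tgt (T.t Y)) := by
  obtain ⟨x, h⟩ := h
  have e := h.t.tgt
  rw [t_vid] at e
  rw [← e]
  exact h.r.symm.trans (T.r_vid x)

theorem exists_hor (h : T.IsUnitPair X Y) :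
    ∃ x, T.hor.IsComp (T.t X) (T.t Y) x ∧ T.hor.IsComp (T.b X) (T.b Y) x := by
  obtain ⟨x, h⟩ := h
  have h₁ := h.t
  have h₂ := h.b
  rw [t_vid] at h₁
  rw [b_vid] at h₂
  exact ⟨x, h₁, h₂⟩

theorem eq_right_of_t {Y' : B} (h : T.IsUnitPair X Y) (h' : T.IsUnitPair X Y')
    (e : T.t Y = T.t Y') : Y = Y' := by
  obtain ⟨x, hx, -⟩ := h.exists_hor
  exact (h.hComp_t hx).left_cancel (h'.hComp_t (e ▸ hx))

theorem eq_right_of_b {Y' : B} (h : T.IsUnitPair X Y) (h' : T.IsUnitPair X Y')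
    (e : T.b Y = T.b Y') : Y = Y' := by
  obtain ⟨x, -, hx⟩ := h.exists_hor
  exact (h.hComp_b hx).left_cancel (h'.hComp_b (e ▸ hx))

theorem eq_left_of_t {X' : B} (h : T.IsUnitPair X Y) (h' : T.IsUnitPair X' Y)
    (e : T.t X = T.t X') : X = X' := by
  obtain ⟨x, hx, -⟩ := h.exists_hor
  exact (h.hComp_t hx).right_cancel (h'.hComp_t (e ▸ hx))

theorem eq_left_of_b {X' : B} (h : T.IsUnitPair X Y) (h' : T.IsUnitPair X' Y)
    (e : T.b X = T.b X') : X = X' := by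
  obtain ⟨x, -, hx⟩ := h.exists_hor
  exact (h.hComp_b hx).right_cancel (h'.hComp_b (e ▸ hx))

end IsUnitPair

variable (T) in
/-- The horizontal composition `XYZ` is a vertical identity. -/
def IsUnitTriple (X Y Z : B) : Prop := ∃ M, T.HComp Y Z M ∧ T.IsUnitPair X M

/-- If `XU` and `WZ` are vertical identities, then so is `X (U / W) Z`: both `U` and `Z` can be
extended by vertical identities, and `(U / W) Z = U · id t(Z)`. -/
theorem IsUnitPair.isUnitTriple (h₁ : T.IsUnitPair X U) (h₂ : T.IsUnitPair W Z)
    (h : T.VComp U W Y) : T.IsUnitTriple X Y Z := by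
  obtain ⟨x, h₁⟩ := h₁
  obtain ⟨y, h₂⟩ := h₂
  have hZ : T.VComp (T.vid (T.t Z)) Z Z := vComp_vid_left rfl
  have hr : T.r U = T.l (T.vid (T.t Z)) := by
    rw [← show T.r (T.vid x) = _ from h₁.r, show T.r (T.vid x) = _ from T.r_vid x,
      show T.l (T.vid _) = _ from T.l_vid _]
    have e₁ : T.hor.tgt (T.t U) = T.hor.tgt x := by rw [← h₁.t.tgt, t_vid]
    have e₂ : T.hor.tgt (T.b U) = T.hor.src (T.t Z) := by rw [h.b_eq_t, h₂.t.tgt_eq_src]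
    have e₃ : T.hor.tgt (T.b U) = T.hor.tgt x := by rw [← h₁.b.tgt, b_vid]
    rw [← e₂, e₃]
  obtain ⟨M, hM⟩ := exists_hComp hr
  obtain ⟨L, hL, hL'⟩ := hM.interchange h₂ h hZ
  obtain rfl := hL.eq_of_id_right
  refine ⟨L, hL', ?_⟩
  have ht : T.hor.tgt x = T.hor.src (T.t Z) := by
    have e : T.hor.tgt x = T.hor.tgt (T.b U) := by rw [← h₁.b.tgt, b_vid]
    rw [e, h.b_eq_t, h₂.t.tgt_eq_src]
  obtain ⟨z, hz⟩ := exists_isComp (G := T.hor) ht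
  exact ⟨z, h₁.assoc hM (hComp_vid hz)⟩

/-- If `XU` and `WZ` are vertical identities, then so is `X (W / U) Z`, since
`(W / U) Z = U · id b(Z)`. -/
theorem IsUnitPair.isUnitTriple' (h₁ : T.IsUnitPair X U) (h₂ : T.IsUnitPair W Z)
    (h : T.VComp W U Y) : T.IsUnitTriple X Y Z := by
  obtain ⟨x, h₁⟩ := h₁
  obtain ⟨y, h₂⟩ := h₂
  have hZ : T.VComp Z (T.vid (T.b Z)) Z := vComp_vid_right rfl
  have ht : T.hor.tgt x = T.hor.src (T.b Z) := by
    have e : T.hor.tgt x = T.hor.tgt (T.t U) := by rw [← h₁.t.tgt, t_vid]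
    rw [e, ← h.b_eq_t, h₂.b.tgt_eq_src]
  have hr : T.r U = T.l (T.vid (T.b Z)) := by
    rw [← show T.r (T.vid x) = _ from h₁.r, show T.r (T.vid x) = _ from T.r_vid x,
      show T.l (T.vid _) = _ from T.l_vid _, ht]
  obtain ⟨M, hM⟩ := exists_hComp hr
  obtain ⟨L, hL, hL'⟩ := h₂.interchange hM h hZ
  obtain rfl := hL.eq_of_id_left
  refine ⟨L, hL', ?_⟩
  obtain ⟨z, hz⟩ := exists_isComp (G := T.hor) ht
  exact ⟨z, h₁.assoc hM (hComp_vid hz)⟩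

theorem exists_isUnitPair_right {x : H} (h : T.l X = T.ver.id (T.hor.src x)) :
    ∃ U, T.HComp X U (T.vid x) := exists_hComp_left (h.trans (T.l_vid x).symm)

theorem exists_isUnitPair_left {y : H} (h : T.r Z = T.ver.id (T.hor.tgt y)) :
    ∃ W, T.HComp W Z (T.vid y) := exists_hComp_right (h.trans (T.r_vid y).symm)

theorem IsUnitTriple.l_left (h : T.IsUnitTriple X Y Z) : T.l X = T.ver.id (T.hor.src (T.t X)) := by
  obtain ⟨M, -, hX⟩ := h; exact hX.l

theorem IsUnitTriple.r_right (h : T.IsUnitTriple X Y Z) :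
    T.r Z = T.ver.id (T.hor.tgt (T.t Z)) := by
  obtain ⟨M, hM, hX⟩ := h
  rw [← hM.t.tgt, ← hX.r]
  exact hM.r.symm

/-- The middle factor of a unit triple is determined by the outer factors and its top edge. -/
theorem IsUnitTriple.eq_of_t {Y' : B} (h : T.IsUnitTriple X Y Z) (h' : T.IsUnitTriple X Y' Z)
    (e : T.t Y = T.t Y') : Y = Y' := by
  obtain ⟨M, hM, hX⟩ := h
  obtain ⟨M', hM', hX'⟩ := h'
  have ht := hM.t
  rw [e] at ht
  obtain rfl := hX.eq_right_of_t hX' (ht.unique hM'.t)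
  exact hM.right_cancel hM'

theorem IsUnitTriple.exists_hor (h : T.IsUnitTriple X Y Z) : ∃ m n w,
    T.hor.IsComp (T.t Y) (T.t Z) m ∧ T.hor.IsComp (T.t X) m w ∧
    T.hor.IsComp (T.b Y) (T.b Z) n ∧ T.hor.IsComp (T.b X) n w := by
  obtain ⟨M, hM, hX⟩ := h
  obtain ⟨w, hw, hw'⟩ := hX.exists_hor
  exact ⟨_, _, w, hM.t, hw, hM.b, hw'⟩

/-- Every unit triple `(X, Y, Z)` arises from a decomposition `Y = U / W` such that `XU` and `WZ`
are vertical identities. -/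
theorem IsUnitTriple.exists_split (h : T.IsUnitTriple X Y Z) :
    ∃ U W, T.IsUnitPair X U ∧ T.IsUnitPair W Z ∧ T.VComp U W Y := by
  obtain ⟨m, n, w, hm, hmw, hn, hnw⟩ := h.exists_hor
  obtain ⟨x, hx⟩ := exists_isComp (hmw.tgt_eq_src.trans hm.src)
  obtain ⟨U, hU⟩ := exists_isUnitPair_right (T := T) (X := X) (x := x) (by rw [hx.src, h.l_left])
  have tz : T.hor.tgt (T.t Z) = T.hor.tgt (T.b Z) := by
    rw [← hm.tgt, ← hn.tgt, ← hmw.tgt, ← hnw.tgt]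
  obtain ⟨W, hW⟩ := exists_isUnitPair_left (T := T) (Z := Z) (y := n)
    (by rw [hn.tgt, h.r_right, tz])
  have htU : T.t U = T.t Y := by
    have := hU.t; rw [t_vid] at this
    exact this.left_cancel hx
  -- Both sides of `b(U) = t(W)` become equal after multiplication by `b(X)` and `t(Z)`.
  have hbt : T.b U = T.t W := by
    have h₁ := hU.b
    rw [b_vid] at h₁
    have h₂ := hW.t
    rw [t_vid] at h₂
    have h₃ : T.hor.IsComp x (T.t Z) w := hx.assoc_symm hm hmw
    obtain ⟨q, hq⟩ := exists_isComp (h₁.tgt.symm.trans h₃.tgt_eq_src)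
    have h₄ := h₁.assoc hq h₃
    obtain rfl := h₄.left_cancel hnw
    exact hq.right_cancel h₂
  obtain ⟨Y', hY'⟩ := exists_vComp hbt
  have := IsUnitPair.isUnitTriple ⟨_, hU⟩ ⟨_, hW⟩ hY'
  obtain rfl := this.eq_of_t h (hY'.t.trans htU)
  exact ⟨U, W, ⟨_, hU⟩, ⟨_, hW⟩, hY'⟩

/-- Every unit triple `(X, Y, Z)` arises from a decomposition `Y = W / U` such that `XU` and `WZ`
are vertical identities. -/
theorem IsUnitTriple.exists_split' (h : T.IsUnitTriple X Y Z) :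
    ∃ U W, T.IsUnitPair X U ∧ T.IsUnitPair W Z ∧ T.VComp W U Y := by
  obtain ⟨m, n, w, hm, hmw, hn, hnw⟩ := h.exists_hor
  obtain ⟨x, hx⟩ := exists_isComp (hnw.tgt_eq_src.trans hn.src)
  have sx : T.hor.src (T.t X) = T.hor.src (T.b X) := by rw [← hmw.src, ← hnw.src]
  obtain ⟨U, hU⟩ := exists_isUnitPair_right (T := T) (X := X) (x := x)
    (by rw [hx.src, h.l_left, sx])
  obtain ⟨W, hW⟩ := exists_isUnitPair_left (T := T) (Z := Z) (y := m)
    (by rw [hm.tgt, h.r_right])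
  have htW : T.t W = T.t Y := by
    have := hW.t; rw [t_vid] at this
    exact this.right_cancel hm
  have hbt : T.b W = T.t U := by
    have h₁ := hU.t
    rw [t_vid] at h₁
    have h₂ := hW.b
    rw [b_vid] at h₂
    have h₃ : T.hor.IsComp x (T.b Z) w := hx.assoc_symm hn hnw
    obtain ⟨q, hq⟩ := exists_isComp (h₁.tgt.symm.trans h₃.tgt_eq_src)
    have h₄ := h₁.assoc hq h₃
    obtain rfl := h₄.left_cancel hmw
    exact h₂.right_cancel hq
  obtain ⟨Y', hY'⟩ := exists_vComp hbt
  have := IsUnitPair.isUnitTriple' ⟨_, hU⟩ ⟨_, hW⟩ hY'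
  obtain rfl := this.eq_of_t h (hY'.t.trans htW)
  exact ⟨U, W, ⟨_, hU⟩, ⟨_, hW⟩, hY'⟩

end DoubleGroupoid

namespace DoubleGroupoid

open ArrowGroupoid

variable {P H V B : Type*} {T : DoubleGroupoid P H V B} {X Y Z W A C D E F R S : B}

/-! ### Factorizations of a vertical composition -/

/-- Suppose that `RS = A / C`. Every `Y` with the right edge of `A` and the top edge of `S` extends
uniquely to factorizations `A = XY`, `C = ZW` with `R = X / Z` and `S = Y / W`. -/
theorem exists_factorizations_of_vComp (h : T.HComp R S E) (hE : T.VComp A C E)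
    (hr : T.r Y = T.r A) (ht : T.t Y = T.t S) :
    ∃ X Z W, T.HComp X Y A ∧ T.HComp Z W C ∧ T.VComp X Z R ∧ T.VComp Y W S := by
  obtain ⟨X, hX⟩ := exists_hComp_right hr
  obtain ⟨W, hW⟩ := exists_vComp_left ht
  have htX : T.t X = T.t R := by
    have h₁ := hX.t
    rw [ht, ← hE.t] at h₁
    exact h₁.right_cancel h.t
  obtain ⟨Z, hZ⟩ := exists_vComp_left htX
  have hZW : T.r Z = T.l W := by
    have h₁ := hZ.r
    rw [hX.r_eq_l, h.r_eq_l] at h₁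
    exact h₁.left_cancel hW.l
  obtain ⟨C', hC'⟩ := exists_hComp hZW
  obtain ⟨L, hL, hL'⟩ := hX.interchange hC' hZ hW
  obtain rfl := hL'.unique h
  obtain rfl := hL.left_cancel hE
  exact ⟨X, Z, W, hX, hC', hZ, hW⟩

/-! ### The boxes occurring in the target and source maps -/

theorem IsCounitPair.b_eq (h : T.IsCounitPair A C) : T.b C = T.hor.id (T.bl C) := by
  obtain ⟨g, h⟩ := h
  have e := h.l.tgt
  rw [l_hid] at e
  rw [← h.b, show T.b (T.hid g) = _ from T.b_hid g, e]

theorem IsCounitPair.t_eq (h : T.IsCounitPair A C) : T.t A = T.hor.id (T.ver.src (T.l A)) := by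
  obtain ⟨g, h⟩ := h
  rw [← h.t, show T.t (T.hid g) = _ from T.t_hid g, ← h.l.src, l_hid]

/-- If `l(A)` is an identity, the horizontal identity `A / C` is the one of `l(C)`. -/
theorem IsCounitPair.vComp_l (h : T.IsCounitPair A C) {p : P} (hA : T.l A = T.ver.id p) :
    T.VComp A C (T.hid (T.l C)) := by
  obtain ⟨g, h⟩ := h
  have e := h.l
  rw [hA, l_hid] at e
  rwa [← e.eq_of_id_left]

/-- If `r(C)` is an identity, the horizontal identity `A / C` is the one of `r(A)`. -/
theorem IsCounitPair.vComp_r (h : T.IsCounitPair A C) {p : P} (hC : T.r C = T.ver.id p) :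
    T.VComp A C (T.hid (T.r A)) := by
  obtain ⟨g, h⟩ := h
  have e := h.r
  rw [hC, r_hid] at e
  rwa [← e.eq_of_id_right]

variable (T) in
/-- `F` occurs in the value of the target map at `A`. -/
def IsTargetTerm (A F : B) : Prop := ∃ X, T.IsUnitPair X F ∧ T.IsCounitPair X A

variable (T) in
/-- `E` occurs in the value of the source map at `A`. -/
def IsSourceTerm (A E : B) : Prop := ∃ Y, T.IsUnitPair E Y ∧ T.IsCounitPair A Y

theorem IsTargetTerm.eq_of_t {F' : B} (h : T.IsTargetTerm A F) (h' : T.IsTargetTerm A F')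
    (e : T.t F = T.t F') : F = F' := by
  obtain ⟨X, hX, hA⟩ := h
  obtain ⟨X', hX', hA'⟩ := h'
  obtain rfl := (hA.vComp_l hX.l).right_cancel (hA'.vComp_l hX'.l)
  exact hX.eq_right_of_t hX' e

theorem IsSourceTerm.eq_of_b {E' : B} (h : T.IsSourceTerm A E) (h' : T.IsSourceTerm A E')
    (e : T.b E = T.b E') : E = E' := by
  obtain ⟨Y, hY, hA⟩ := h
  obtain ⟨Y', hY', hA'⟩ := h'
  obtain rfl := (hA.vComp_r hY.r).left_cancel (hA'.vComp_r hY'.r)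
  exact hY.eq_left_of_b hY' e

theorem IsTargetTerm.b_eq (h : T.IsTargetTerm A F) : T.b A = T.hor.id (T.bl A) := by
  obtain ⟨X, -, hA⟩ := h; exact hA.b_eq

theorem IsSourceTerm.t_eq (h : T.IsSourceTerm A E) : T.t A = T.hor.id (T.ver.src (T.l A)) := by
  obtain ⟨Y, -, hA⟩ := h; exact hA.t_eq

theorem IsTargetTerm.src_t (h : T.IsTargetTerm A F) :
    T.hor.src (T.t F) = T.hor.src (T.t A) := by
  obtain ⟨X, hX, hA⟩ := h
  obtain ⟨x, hx, -⟩ := hX.exists_hor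
  have e := (hA.vComp_l hX.l).t
  rw [← hx.tgt_eq_src, ← e, show T.t (T.hid _) = _ from T.t_hid _, T.hor.tgt_id]
  exact (T.lt_eq_tl A).symm

theorem IsTargetTerm.bl_eq (h : T.IsTargetTerm A F) : T.bl F = T.hor.tgt (T.t A) := by
  obtain ⟨X, ⟨x, hX⟩, ⟨g, hA⟩⟩ := h
  rw [show T.bl F = T.ver.tgt (T.l F) from rfl, ← hX.r_eq_l, ← hA.b_eq_t]
  exact (T.rb_eq_br X).symm

theorem IsSourceTerm.tgt_b (h : T.IsSourceTerm A E) :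
    T.hor.tgt (T.b E) = T.ver.tgt (T.r A) := by
  obtain ⟨Y, hY, hA⟩ := h
  obtain ⟨x, -, hx⟩ := hY.exists_hor
  have e := (hA.vComp_r hY.r).b
  rw [hx.tgt_eq_src, ← e, show T.b (T.hid _) = _ from T.b_hid _, T.hor.src_id]

/-- If `A = YZ` and `b(A)` is an identity, then `F = Y / Z⁻¹` is defined and occurs in the target
map at `A`: with `X = id l(A) / A⁻ᵛ` one has `XF = Y / Y⁻ᵛ`. -/
theorem HComp.exists_isTargetTerm (h : T.HComp Y Z A) {p : P} (hA : T.b A = T.hor.id p) :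
    ∃ F, T.VComp Y (T.inv Z) F ∧ T.IsTargetTerm A F := by
  have hb : T.b Y = T.t (T.inv Z) := by
    have e := h.b
    rw [hA] at e
    rw [t_inv]
    exact e.inv_right.eq_of_id_left
  obtain ⟨F, hF⟩ := exists_vComp hb
  have hX : T.b A = T.b (T.hid (T.l A)) := by
    rw [show T.b (T.hid _) = _ from T.b_hid _, ← T.lb_eq_bl]
    change T.b A = T.hor.id (T.hor.src (T.b A))
    rw [hA, T.hor.src_id]
  obtain ⟨X, hX⟩ := exists_vComp_right hX
  have h₁ : T.HComp (T.hid (T.l A)) Y Y := hComp_hid_left h.l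
  have h₂ : T.HComp (T.vinv A) (T.inv Z) (T.vinv Y) := h.vinv.inv_right
  obtain ⟨L, hL, hL'⟩ := h₁.interchange h₂ hX.inv_right hF
  obtain rfl := hL.unique (IsComp.self_inv Y)
  exact ⟨F, hF, X, ⟨_, hL'⟩, ⟨_, hX⟩⟩

/-- If `A = YZ` and `t(A)` is an identity, then `E = Y⁻¹ / Z` is defined and occurs in the source
map at `A`: with `Y' = A⁻ᵛ / id r(A)` one has `EY' = Z⁻ᵛ / Z`. -/
theorem HComp.exists_isSourceTerm (h : T.HComp Y Z A) {p : P} (hA : T.t A = T.hor.id p) :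
    ∃ E, T.VComp (T.inv Y) Z E ∧ T.IsSourceTerm A E := by
  have ht : T.b (T.inv Y) = T.t Z := by
    have e := h.t
    rw [hA] at e
    rw [b_inv]
    exact e.inv_left.eq_of_id_right.symm
  obtain ⟨E, hE⟩ := exists_vComp ht
  have hX : T.t A = T.t (T.hid (T.r A)) := by
    rw [show T.t (T.hid _) = _ from T.t_hid _, ← T.rt_eq_tr]
    change T.t A = T.hor.id (T.hor.tgt (T.t A))
    rw [hA, T.hor.tgt_id]
  obtain ⟨Y', hY'⟩ := exists_vComp_left hX
  have h₁ : T.HComp (T.inv Y) (T.vinv A) (T.vinv Z) := h.vinv.inv_left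
  have h₂ : T.HComp Z (T.hid (T.r A)) Z := hComp_hid_right h.r
  obtain ⟨L, hL, hL'⟩ := h₁.interchange h₂ hE hY'.inv_left
  obtain rfl := hL.unique (IsComp.inv_self Z)
  exact ⟨E, hE, Y', ⟨_, hL'⟩, ⟨_, hY'⟩⟩

/-- Converse of `HComp.exists_isTargetTerm`: a term `F` of the target map at `A` comes from one
factorization `A = YZ` for each `Z` with the right edge of `A` and `t(F) t(Z) = t(A)`. -/
theorem IsTargetTerm.exists_hComp (h : T.IsTargetTerm A F) (hr : T.r Z = T.r A)
    (ht : T.hor.IsComp (T.t F) (T.t Z) (T.t A)) :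
    ∃ Y, T.HComp Y Z A ∧ T.VComp Y (T.inv Z) F := by
  obtain ⟨Y, hY⟩ := exists_hComp_right hr
  obtain ⟨F', hF', hAF'⟩ := hY.exists_isTargetTerm h.b_eq
  obtain rfl := h.eq_of_t hAF' ((ht.right_cancel hY.t).trans hF'.t.symm)
  exact ⟨Y, hY, hF'⟩

/-- Converse of `HComp.exists_isSourceTerm`: a term `E` of the source map at `A` comes from one
factorization `A = YZ` for each `Z` with the right edge of `A` and the bottom edge of `E`. -/
theorem IsSourceTerm.exists_hComp (h : T.IsSourceTerm A E) (hr : T.r Z = T.r A)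
    (hb : T.b Z = T.b E) : ∃ Y, T.HComp Y Z A ∧ T.VComp (T.inv Y) Z E := by
  obtain ⟨Y, hY⟩ := exists_hComp_right hr
  obtain ⟨E', hE', hAE'⟩ := hY.exists_isSourceTerm h.t_eq
  obtain rfl := h.eq_of_b hAE' (hb.symm.trans hE'.b.symm)
  exact ⟨Y, hY, hE'⟩

/-- If `A = XY` and `b(Y)` is an identity, the box `F = X⁻ʰ / A⁻¹` occurs in the target map at `Y`,
and placing it below `X⁻¹` gives `A⁻¹`. By `IsTargetTerm.eq_of_t` it is the only term of the target
map at `Y` that fits below `X⁻¹`. -/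
theorem HComp.exists_inv_vComp (h : T.HComp X Y A) {p : P} (hY : T.b Y = T.hor.id p) :
    ∃ F, T.IsTargetTerm Y F ∧ T.VComp (T.inv X) F (T.inv A) := by
  have h₁ : T.HComp (T.hinv X) A Y := h.inv_left
  obtain ⟨F, hF, hF'⟩ := h₁.exists_isTargetTerm hY
  refine ⟨F, hF', ?_⟩
  rw [← vinv_hinv X]
  exact hF.inv_left

/-! ### Boxes with an identity on the left or on the right, and the core -/

theorem IsTargetTerm.r_eq (h : T.IsTargetTerm A F) : T.ver.IsId (T.r F) := by
  obtain ⟨X, hX, -⟩ := h; exact ⟨_, hX.r⟩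

theorem IsSourceTerm.l_eq (h : T.IsSourceTerm A E) : T.ver.IsId (T.l E) := by
  obtain ⟨Y, hY, -⟩ := h; exact ⟨_, hY.l⟩

/-- A box `E` with identity left edge is `id b(E) · D` for a core box `D`, so that its right
vertices are connected in the core groupoid. -/
theorem core_connected_of_isId_l (h : T.ver.IsId (T.l E)) :
    T.core.Connected (T.hor.tgt (T.t E)) (T.hor.tgt (T.b E)) := by
  obtain ⟨p, hp⟩ := h
  change T.l E = _ at hp
  have hl : T.l (T.vid (T.b E)) = T.l E := by
    rw [show T.l (T.vid _) = _ from T.l_vid _]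
    change T.ver.id (T.hor.src (T.boxV.tgt E)) = _
    rw [T.lb_eq_bl]
    change T.ver.id (T.ver.tgt (T.l E)) = _
    rw [hp, T.ver.tgt_id]
  obtain ⟨D, hD⟩ := exists_hComp_left hl
  have hDl : T.l D = T.ver.id (T.hor.tgt (T.b E)) := hD.r_eq_l.symm.trans (T.r_vid _)
  have hDb : T.b D = T.hor.id (T.hor.tgt (T.b E)) := by
    have e := hD.b
    rw [b_vid] at e
    exact e.left_cancel (IsComp.id_right rfl)
  refine ⟨⟨D, ⟨_, hDl⟩, ⟨_, hDb⟩⟩, ?_, ?_⟩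
  · exact hD.t.tgt.symm
  · exact hD.t.tgt_eq_src.symm.trans (by rw [t_vid])

theorem core_connected_of_isId_r (h : T.ver.IsId (T.r F)) :
    T.core.Connected (T.hor.src (T.b F)) (T.hor.src (T.t F)) := by
  obtain ⟨p, hp⟩ := h
  change T.r F = _ at hp
  have := core_connected_of_isId_l (T := T) (E := T.inv F)
    ⟨p, by rw [l_inv', hp, inv_ver_id]⟩
  rwa [t_inv, b_inv, T.hor.tgt_inv, T.hor.tgt_inv] at this

/-- A core box occurs in the source map at its inverse. -/
theorem IsCore.isSourceTerm_inv (h : T.IsCore D) : T.IsSourceTerm (T.inv D) D := by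
  obtain ⟨⟨p, hp⟩, ⟨q, hq⟩⟩ := h
  change T.l D = _ at hp
  change T.b D = _ at hq
  refine ⟨T.hinv D, ⟨T.hor.id p, ?_⟩, ⟨T.ver.id q, ?_⟩⟩
  · rw [show T.vid (T.hor.id p) = T.hid (T.ver.id p) from T.vid_id p, ← hp]
    exact IsComp.self_inv D
  · rw [show T.hid (T.ver.id q) = T.vid (T.hor.id q) from (T.vid_id q).symm]
    have e : T.b (T.hinv D) = T.hor.id q := by rw [b_hinv, hq, ArrowGroupoid.inv_id]
    rw [← e, ← vinv_hinv]
    exact IsComp.inv_self (T.hinv D)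

end DoubleGroupoid

/-! ### Counting boxes with a given corner -/

/-- Connected points of a finite groupoid are the target of equally many arrows. -/
theorem ArrowGroupoid.Connected.card_tgt_eq {O A : Type*} {G : ArrowGroupoid O A} {p q : O}
    (h : G.Connected p q) :
    Nat.card {a // G.tgt a = p} = Nat.card {a // G.tgt a = q} := by
  obtain ⟨f, rfl, rfl⟩ := h
  refine Nat.card_congr (Equiv.ofBijective
    (fun a => ⟨G.comp a.1 f a.2, G.tgt_comp _ _ _⟩) ⟨fun a a' h => ?_, fun c => ?_⟩)
  · have e := congrArg Subtype.val h
    have h₁ := isComp_comp (G := G) a.2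
    rw [show G.comp a.1 f a.2 = _ from e] at h₁
    exact Subtype.ext (h₁.right_cancel (isComp_comp a'.2))
  · obtain ⟨a, ha⟩ := exists_isComp_right (G := G) c.2.symm
    exact ⟨⟨a, ha.tgt_eq_src⟩, Subtype.ext ((isComp_comp _).unique ha)⟩

namespace DoubleGroupoid

open ArrowGroupoid

variable {P H V B : Type*} {T : DoubleGroupoid P H V B}

/-- Boxes with right edge `g` and identity top edge correspond, by placing them below the
horizontal identity of `g⁻¹`, to boxes with identity right and top edges. -/
theorem urCorner_id (g : V) : T.urCorner g (T.hor.id (T.ver.src g)) =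
    T.urCorner (T.ver.id (T.ver.tgt g)) (T.hor.id (T.ver.tgt g)) := by
  have hb : T.b (T.hid (T.ver.inv g)) = T.hor.id (T.ver.src g) := by
    rw [show T.b (T.hid _) = _ from T.b_hid _, T.ver.tgt_inv]
  have ht : T.t (T.hid (T.ver.inv g)) = T.hor.id (T.ver.tgt g) := by
    rw [show T.t (T.hid _) = _ from T.t_hid _, T.ver.src_inv]
  refine Nat.card_congr (Equiv.ofBijective (fun U => ⟨T.vcomp (T.hid (T.ver.inv g)) U.1
    (hb.trans U.2.2.symm), ?_, ?_⟩) ⟨fun U U' h => ?_, fun W => ?_⟩)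
  · have key : ∀ E, T.VComp (T.hid (T.ver.inv g)) U.1 E → T.r E = T.ver.id (T.ver.tgt g) := by
      intro E h
      have e := h.r
      rw [r_hid, U.2.1] at e
      exact e.unique (IsComp.inv_self g)
    exact key _ (isComp_comp _)
  · exact (T.boxV.src_comp _ _ _).trans ht
  · have e := congrArg Subtype.val h
    have h₁ : T.VComp (T.hid (T.ver.inv g)) U.1 _ := isComp_comp (hb.trans U.2.2.symm)
    rw [show T.boxV.comp _ U.1 _ = _ from e] at h₁
    exact Subtype.ext (h₁.left_cancel (isComp_comp (hb.trans U'.2.2.symm)))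
  · obtain ⟨U, hU⟩ := exists_vComp_left (T := T) (A := T.hid (T.ver.inv g)) (E := W.1)
      (ht.trans W.2.2.symm)
    refine ⟨⟨U, ?_, hU.b_eq_t.symm.trans hb⟩, Subtype.ext ((isComp_comp _).unique hU)⟩
    have e := hU.r
    rw [r_hid, W.2.1] at e
    exact e.left_cancel (IsComp.inv_self g)

/-- The corner function depends only on the bottom left vertex. -/
theorem urCorner_eq (X : B) : T.urCorner (T.r X) (T.t X) =
    T.urCorner (T.ver.id (T.bl X)) (T.hor.id (T.bl X)) := by
  have h := urCorner_hcomp (T.hid (T.l X)) X (r_hid _)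
  rw [show T.hcomp (T.hid (T.l X)) X _ = X from id_comp' _, r_hid,
    show T.t (T.hid _) = _ from T.t_hid _] at h
  rw [h, urCorner_id]

theorem urCorner_id_eq_card_core (p : P) : T.urCorner (T.ver.id p) (T.hor.id p) =
    Nat.card {D : T.Core // T.core.tgt D = p} := by
  refine Nat.card_congr
    { toFun := fun U => ⟨⟨T.inv U.1, ⟨p, ?_⟩, ⟨p, ?_⟩⟩, ?_⟩
      invFun := fun D => ⟨T.inv D.1.1, ?_, ?_⟩
      left_inv := fun U => Subtype.ext (inv_inv _)
      right_inv := fun D => Subtype.ext (Subtype.ext (inv_inv _)) }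
  · rw [l_inv', U.2.1, ArrowGroupoid.inv_id]
  · rw [b_inv, U.2.2, ArrowGroupoid.inv_id]
  · change T.hor.src (T.t (T.inv U.1)) = p
    rw [t_inv, T.hor.src_inv]
    refine (T.rb_eq_br U.1).trans ?_
    rw [show T.boxH.tgt U.1 = _ from U.2.1, T.ver.tgt_id]
  · have e : T.hor.src (T.t D.1.1) = p := D.2
    rw [r_inv', D.1.2.l_eq, ArrowGroupoid.inv_id, e]
  · have e : T.hor.src (T.t D.1.1) = p := D.2
    rw [t_inv, D.1.2.b_eq, ArrowGroupoid.inv_id, e]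

end DoubleGroupoid

/-! ### Double counting -/

/-- Two sums agree if the nonzero terms of one correspond, by a relation that is injective in both
directions, to equal terms of the other. -/
theorem Finset.sum_eq_sum_of_rel {α β M : Type*} [AddCommMonoid M] {s : Finset α} {t : Finset β}
    {f : α → M} {g : β → M} (r : α → β → Prop)
    (hs : ∀ a ∈ s, f a ≠ 0 → ∃ b ∈ t, r a b) (ht : ∀ b ∈ t, ∃ a ∈ s, r a b)
    (hr : ∀ a ∈ s, ∀ b ∈ t, ∀ b' ∈ t, r a b → r a b' → b = b')
    (hl : ∀ a ∈ s, ∀ a' ∈ s, ∀ b ∈ t, r a b → r a' b → a = a')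
    (h : ∀ a ∈ s, ∀ b ∈ t, r a b → f a = g b) : ∑ a ∈ s, f a = ∑ b ∈ t, g b := by
  choose i hi hri using hs
  refine Finset.sum_bij_ne_zero i hi ?_ ?_ ?_
  · intro a ha ha' c hc hc' e
    exact hl a ha c hc _ (hi a ha ha') (hri a ha ha') (e ▸ hri c hc hc')
  · intro b hb hb'
    obtain ⟨a, ha, hab⟩ := ht b hb
    have ha' : f a ≠ 0 := by rwa [h a ha b hb hab]
    exact ⟨a, ha, ha', hr a ha _ (hi a ha ha') b hb (hri a ha ha') hab⟩
  · intro a ha ha'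
    exact h a ha _ (hi a ha ha') (hri a ha ha')

/-! ### Products of elements of a threefold tensor power -/

section TensorCube

open TensorProduct

variable {k A ι κ : Type*} [CommRing k] [Ring A] [Algebra k A] (s : Finset ι) (t : Finset κ)
  (c : ι → k) (d : κ → k) (x y : ι → A) (u v : κ → A)

theorem assoc_sum_tmul_one_mul_one_tmul_sum :
    TensorProduct.assoc k A A A ((∑ i ∈ s, c i • (x i ⊗ₜ[k] y i)) ⊗ₜ[k] (1 : A)) *
      ((1 : A) ⊗ₜ[k] ∑ j ∈ t, d j • (u j ⊗ₜ[k] v j)) =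
    ∑ q ∈ s ×ˢ t, (c q.1 * d q.2) • (x q.1 ⊗ₜ[k] ((y q.1 * u q.2) ⊗ₜ[k] v q.2)) := by
  simp only [TensorProduct.sum_tmul, TensorProduct.tmul_sum, map_sum,
    ← TensorProduct.smul_tmul', TensorProduct.tmul_smul, map_smul, TensorProduct.assoc_tmul]
  rw [Finset.sum_mul_sum, ← Finset.sum_product']
  simp only [smul_mul_smul_comm, Algebra.TensorProduct.tmul_mul_tmul, mul_one, one_mul]

theorem one_tmul_sum_mul_assoc_sum_tmul_one :
    ((1 : A) ⊗ₜ[k] ∑ j ∈ t, d j • (u j ⊗ₜ[k] v j)) *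
      TensorProduct.assoc k A A A ((∑ i ∈ s, c i • (x i ⊗ₜ[k] y i)) ⊗ₜ[k] (1 : A)) =
    ∑ q ∈ s ×ˢ t, (c q.1 * d q.2) • (x q.1 ⊗ₜ[k] ((u q.2 * y q.1) ⊗ₜ[k] v q.2)) := by
  simp only [TensorProduct.sum_tmul, TensorProduct.tmul_sum, map_sum,
    ← TensorProduct.smul_tmul', TensorProduct.tmul_smul, map_smul, TensorProduct.assoc_tmul]
  rw [Finset.sum_mul_sum, Finset.sum_comm, ← Finset.sum_product']
  simp only [smul_mul_smul_comm, Algebra.TensorProduct.tmul_mul_tmul, mul_one, one_mul,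
    mul_comm (c _)]

end TensorCube

/-! ### The box algebra on its basis -/

namespace DoubleGroupoid

open ArrowGroupoid Coalgebra

variable {P H V B k : Type*} [Field k] {T : DoubleGroupoid P H V B}

theorem vertexWeight_apply (ϑ : P → kˣ) (X : B) : (T.vertexWeight ϑ).toFun X = ϑ (T.bl X) := rfl

namespace BoxAlgebra

variable {w : T.Weight k} {A C E X Y : B}

section Algebra

variable [Fintype H]

theorem single_mul_single_of_vComp (h : T.VComp A C E) :
    single w A * single w C = single w E :=
  (mulLin_single A C).trans ((boxMul_of_eq h.1).trans (congrArg _ h.2))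

theorem single_mul_single_of_ne (h : T.b A ≠ T.t C) : single w A * single w C = 0 :=
  (mulLin_single A C).trans (boxMul_of_ne h)

theorem one_eq_sum : (1 : BoxAlgebra w) = ∑ x : H, single w (T.vid x) := rfl

end Algebra

variable [Fintype B]

theorem mem_factorizations_iff {p : B × B} :
    p ∈ factorizations T A ↔ T.HComp p.1 p.2 A := mem_factorizations

open Classical in
variable (T) in
/-- The pairs of boxes whose horizontal composition is a vertical identity. -/
noncomputable def unitPairs : Finset (B × B) :=
  Finset.univ.filter fun p => T.IsUnitPair p.1 p.2

theorem mem_unitPairs {p : B × B} : p ∈ unitPairs T ↔ T.IsUnitPair p.1 p.2 := by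
  simp [unitPairs]

theorem comul_one_eq [Fintype H] : comul (R := k) (1 : BoxAlgebra w) =
    ∑ p ∈ unitPairs T, (w.toFun p.2 : k) • (single w p.1 ⊗ₜ[k] single w p.2) := by
  classical
  have h : unitPairs T = Finset.univ.biUnion fun x : H => factorizations T (T.vid x) := by
    ext p
    simp only [mem_unitPairs, Finset.mem_biUnion, Finset.mem_univ, true_and,
      mem_factorizations_iff]
    rfl
  rw [one_eq_sum, map_sum, h, Finset.sum_biUnion]
  · exact Finset.sum_congr rfl fun x _ => comul_single _
  · intro x _ y _ hxy
    refine Finset.disjoint_left.2 fun p hp hp' => hxy ?_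
    rw [mem_factorizations_iff] at hp hp'
    exact id_injective (hp.unique hp')

/-! ### The weak bialgebra axioms for the comultiplication -/

variable [Fintype H] {ϑ : P → kˣ}

open Classical in
theorem comul_single_mul_single (hϑ : T.IsNormalized ϑ) (A C : B) :
    comul (R := k) (single (T.vertexWeight ϑ) A * single (T.vertexWeight ϑ) C) =
      comul (R := k) (single (T.vertexWeight ϑ) A) *
        comul (R := k) (single (T.vertexWeight ϑ) C) := by
  rw [comul_single A, comul_single C, Finset.sum_mul_sum, ← Finset.sum_product']
  simp only [smul_mul_smul_comm, Algebra.TensorProduct.tmul_mul_tmul]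
  by_cases h : T.b A = T.t C
  · obtain ⟨E, hE⟩ := exists_vComp h
    rw [single_mul_single_of_vComp hE, comul_single]
    -- Insert the normalization condition for the right edge of `A` and the top edge of `S`.
    have hsum : ∀ p ∈ factorizations T E,
        ((T.vertexWeight ϑ).toFun p.2 : k) •
          (single (T.vertexWeight ϑ) p.1 ⊗ₜ[k] single (T.vertexWeight ϑ) p.2) =
        ∑ Y : B with T.r Y = T.r A ∧ T.t Y = T.t p.2,
          ((ϑ (T.bl Y) : k) * ϑ (T.bl p.2)) •
            (single (T.vertexWeight ϑ) p.1 ⊗ₜ[k] single (T.vertexWeight ϑ) p.2) := by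
      intro p hp
      rw [mem_factorizations_iff] at hp
      rw [← Finset.sum_smul, ← Finset.sum_mul, hϑ, one_mul, vertexWeight_apply]
      rw [← hE.r.src, hp.r]
      exact T.rt_eq_tr p.2
    rw [Finset.sum_congr rfl hsum, Finset.sum_sigma']
    symm
    refine Finset.sum_eq_sum_of_rel (fun q a => T.VComp q.1.1 q.2.1 a.1.1 ∧
      T.VComp q.1.2 q.2.2 a.1.2 ∧ q.1.2 = a.2) ?_ ?_ ?_ ?_ ?_
    · rintro ⟨⟨X, Y⟩, Z, W⟩ hq hne
      simp only [Finset.mem_product, mem_factorizations_iff] at hq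
      by_cases h₁ : T.b X = T.t Z
      swap
      · exact absurd (by simp [single_mul_single_of_ne h₁]) hne
      by_cases h₂ : T.b Y = T.t W
      swap
      · exact absurd (by simp [single_mul_single_of_ne h₂]) hne
      obtain ⟨R, hR⟩ := exists_vComp h₁
      obtain ⟨S, hS⟩ := exists_vComp h₂
      obtain ⟨L, hL, hL'⟩ := hq.1.interchange hq.2 hR hS
      obtain rfl := hL.unique hE
      refine ⟨⟨(R, S), Y⟩, ?_, hR, hS, rfl⟩
      simp only [Finset.mem_sigma, mem_factorizations_iff, Finset.mem_filter, Finset.mem_univ,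
        true_and]
      exact ⟨hL', hq.1.r.symm, hS.t.symm⟩
    · rintro ⟨⟨R, S⟩, Y⟩ ha
      simp only [Finset.mem_sigma, mem_factorizations_iff, Finset.mem_filter, Finset.mem_univ,
        true_and] at ha
      obtain ⟨X, Z, W, hX, hZ, hR, hS⟩ :=
        exists_factorizations_of_vComp ha.1 hE ha.2.1 ha.2.2
      exact ⟨((X, Y), Z, W), by simp [mem_factorizations_iff, hX, hZ], hR, hS, rfl⟩
    · rintro ⟨⟨X, Y⟩, Z, W⟩ - ⟨⟨R, S⟩, U⟩ - ⟨⟨R', S'⟩, U'⟩ - ⟨h₁, h₂, h₃⟩ ⟨h₁', h₂', h₃'⟩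
      dsimp only at h₁ h₂ h₃ h₁' h₂' h₃'
      rw [h₁.unique h₁', h₂.unique h₂', ← h₃, ← h₃']
    · rintro ⟨⟨X, Y⟩, Z, W⟩ hq ⟨⟨X', Y'⟩, Z', W'⟩ hq' ⟨⟨R, S⟩, U⟩ - ⟨h₁, h₂, h₃⟩ ⟨h₁', h₂', h₃'⟩
      simp only [Finset.mem_product, mem_factorizations_iff] at hq hq'
      dsimp only at h₁ h₂ h₃ h₁' h₂' h₃'
      subst h₃
      subst h₃'
      obtain rfl := hq.1.right_cancel hq'.1
      rw [h₁.left_cancel h₁', h₂.left_cancel h₂']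
    · rintro ⟨⟨X, Y⟩, Z, W⟩ - ⟨⟨R, S⟩, U⟩ - ⟨h₁, h₂, h₃⟩
      dsimp only at h₁ h₂ h₃ ⊢
      subst h₃
      rw [single_mul_single_of_vComp h₁, single_mul_single_of_vComp h₂, vertexWeight_apply,
        vertexWeight_apply, show T.bl S = T.bl W from h₂.l.tgt]
  · rw [single_mul_single_of_ne h, map_zero]
    refine (Finset.sum_eq_zero ?_).symm
    rintro ⟨⟨X, Y⟩, Z, W⟩ hq
    simp only [Finset.mem_product, mem_factorizations_iff] at hq
    by_cases h₁ : T.b X = T.t Z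
    swap
    · simp [single_mul_single_of_ne h₁]
    by_cases h₂ : T.b Y = T.t W
    swap
    · simp [single_mul_single_of_ne h₂]
    have e := hq.1.b
    rw [h₁, h₂] at e
    exact absurd (e.unique hq.2.t) h

theorem lTensor_comul_comul_one : LinearMap.lTensor (BoxAlgebra w) (comul (R := k))
      (comul (R := k) (1 : BoxAlgebra w)) =
    ∑ a ∈ (unitPairs T).sigma (fun p => factorizations T p.2),
      ((w.toFun a.1.2 : k) * w.toFun a.2.2) •
        (single w a.1.1 ⊗ₜ[k] (single w a.2.1 ⊗ₜ[k] single w a.2.2)) := by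
  simp only [comul_one_eq, map_sum, map_smul, LinearMap.lTensor_tmul, comul_single,
    TensorProduct.tmul_sum, TensorProduct.tmul_smul, Finset.smul_sum, smul_smul]
  rw [Finset.sum_sigma']

theorem lTensor_comul_comul_one_eq :
    LinearMap.lTensor (BoxAlgebra (T.vertexWeight ϑ)) (comul (R := k))
      (comul (R := k) (1 : BoxAlgebra (T.vertexWeight ϑ))) =
    TensorProduct.assoc k _ _ _
        (comul (R := k) (1 : BoxAlgebra (T.vertexWeight ϑ)) ⊗ₜ[k] 1) *
      ((1 : BoxAlgebra (T.vertexWeight ϑ)) ⊗ₜ[k] comul (R := k) 1) := by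
  rw [lTensor_comul_comul_one]
  rw [comul_one_eq, assoc_sum_tmul_one_mul_one_tmul_sum]
  symm
  refine Finset.sum_eq_sum_of_rel (fun q a => q.1.1 = a.1.1 ∧ q.2.2 = a.2.2 ∧
    T.VComp q.1.2 q.2.1 a.2.1) ?_ ?_ ?_ ?_ ?_
  · rintro ⟨⟨X, U⟩, W, Z⟩ hq hne
    simp only [Finset.mem_product, mem_unitPairs] at hq
    by_cases h : T.b U = T.t W
    swap
    · exact absurd (by simp [single_mul_single_of_ne h]) hne
    obtain ⟨Y, hY⟩ := exists_vComp h
    obtain ⟨M, hM, hX⟩ := hq.1.isUnitTriple hq.2 hY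
    exact ⟨⟨(X, M), Y, Z⟩, by simp [mem_unitPairs, mem_factorizations_iff, hM, hX], rfl, rfl, hY⟩
  · rintro ⟨⟨X, M⟩, Y, Z⟩ ha
    simp only [Finset.mem_sigma, mem_unitPairs, mem_factorizations_iff] at ha
    obtain ⟨U, W, hU, hW, hY⟩ := IsUnitTriple.exists_split ⟨M, ha.2, ha.1⟩
    exact ⟨((X, U), W, Z), by simp [mem_unitPairs, hU, hW], rfl, rfl, hY⟩
  · rintro ⟨⟨X, U⟩, W, Z⟩ - ⟨⟨X₁, M₁⟩, Y₁, Z₁⟩ ha₁ ⟨⟨X₂, M₂⟩, Y₂, Z₂⟩ ha₂ ⟨e₁, f₁, h₁⟩ ⟨e₂, f₂, h₂⟩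
    simp only [Finset.mem_sigma, mem_unitPairs, mem_factorizations_iff] at ha₁ ha₂
    dsimp only at e₁ f₁ h₁ e₂ f₂ h₂
    subst e₁ f₁ e₂ f₂
    obtain rfl := h₁.unique h₂
    obtain rfl := ha₁.2.unique ha₂.2
    rfl
  · rintro ⟨⟨X₁, U₁⟩, W₁, Z₁⟩ hq₁ ⟨⟨X₂, U₂⟩, W₂, Z₂⟩ hq₂ ⟨⟨X, M⟩, Y, Z⟩ - ⟨e₁, f₁, h₁⟩ ⟨e₂, f₂, h₂⟩
    simp only [Finset.mem_product, mem_unitPairs] at hq₁ hq₂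
    dsimp only at e₁ f₁ h₁ e₂ f₂ h₂
    subst e₁ f₁ e₂ f₂
    obtain rfl := hq₁.1.eq_right_of_t hq₂.1 (h₁.t.symm.trans h₂.t)
    obtain rfl := hq₁.2.eq_left_of_b hq₂.2 (h₁.b.symm.trans h₂.b)
    rfl
  · rintro ⟨⟨X, U⟩, W, Z⟩ hq ⟨⟨X', M⟩, Y, Z'⟩ ha ⟨e, f, h⟩
    simp only [Finset.mem_product, mem_unitPairs] at hq
    simp only [Finset.mem_sigma, mem_unitPairs, mem_factorizations_iff] at ha
    dsimp only at e f h ⊢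
    subst e f
    rw [single_mul_single_of_vComp h]
    simp only [vertexWeight_apply]
    -- The left edge of `W` is an identity, so `U` and `Y = U / W` have the same left edge.
    have hl := h.l
    rw [hq.2.l] at hl
    rw [show T.bl M = T.bl U by
      change T.ver.tgt (T.l M) = T.ver.tgt (T.l U)
      rw [ha.2.l, hl.eq_of_id_right]]

theorem lTensor_comul_comul_one_eq' :
    LinearMap.lTensor (BoxAlgebra (T.vertexWeight ϑ)) (comul (R := k))
      (comul (R := k) (1 : BoxAlgebra (T.vertexWeight ϑ))) =
    ((1 : BoxAlgebra (T.vertexWeight ϑ)) ⊗ₜ[k] comul (R := k) 1) *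
      TensorProduct.assoc k _ _ _
        (comul (R := k) (1 : BoxAlgebra (T.vertexWeight ϑ)) ⊗ₜ[k] 1) := by
  rw [lTensor_comul_comul_one]
  rw [comul_one_eq, one_tmul_sum_mul_assoc_sum_tmul_one]
  symm
  refine Finset.sum_eq_sum_of_rel (fun q a => q.1.1 = a.1.1 ∧ q.2.2 = a.2.2 ∧
    T.VComp q.2.1 q.1.2 a.2.1) ?_ ?_ ?_ ?_ ?_
  · rintro ⟨⟨X, U⟩, W, Z⟩ hq hne
    simp only [Finset.mem_product, mem_unitPairs] at hq
    by_cases h : T.b W = T.t U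
    swap
    · exact absurd (by simp [single_mul_single_of_ne h]) hne
    obtain ⟨Y, hY⟩ := exists_vComp h
    obtain ⟨M, hM, hX⟩ := hq.1.isUnitTriple' hq.2 hY
    exact ⟨⟨(X, M), Y, Z⟩, by simp [mem_unitPairs, mem_factorizations_iff, hM, hX], rfl, rfl, hY⟩
  · rintro ⟨⟨X, M⟩, Y, Z⟩ ha
    simp only [Finset.mem_sigma, mem_unitPairs, mem_factorizations_iff] at ha
    obtain ⟨U, W, hU, hW, hY⟩ := IsUnitTriple.exists_split' ⟨M, ha.2, ha.1⟩
    exact ⟨((X, U), W, Z), by simp [mem_unitPairs, hU, hW], rfl, rfl, hY⟩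
  · rintro ⟨⟨X, U⟩, W, Z⟩ - ⟨⟨X₁, M₁⟩, Y₁, Z₁⟩ ha₁ ⟨⟨X₂, M₂⟩, Y₂, Z₂⟩ ha₂ ⟨e₁, f₁, h₁⟩ ⟨e₂, f₂, h₂⟩
    simp only [Finset.mem_sigma, mem_unitPairs, mem_factorizations_iff] at ha₁ ha₂
    dsimp only at e₁ f₁ h₁ e₂ f₂ h₂
    subst e₁ f₁ e₂ f₂
    obtain rfl := h₁.unique h₂
    obtain rfl := ha₁.2.unique ha₂.2
    rfl
  · rintro ⟨⟨X₁, U₁⟩, W₁, Z₁⟩ hq₁ ⟨⟨X₂, U₂⟩, W₂, Z₂⟩ hq₂ ⟨⟨X, M⟩, Y, Z⟩ - ⟨e₁, f₁, h₁⟩ ⟨e₂, f₂, h₂⟩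
    simp only [Finset.mem_product, mem_unitPairs] at hq₁ hq₂
    dsimp only at e₁ f₁ h₁ e₂ f₂ h₂
    subst e₁ f₁ e₂ f₂
    obtain rfl := hq₁.1.eq_right_of_b hq₂.1 (h₁.b.symm.trans h₂.b)
    obtain rfl := hq₁.2.eq_left_of_t hq₂.2 (h₁.t.symm.trans h₂.t)
    rfl
  · rintro ⟨⟨X, U⟩, W, Z⟩ hq ⟨⟨X', M⟩, Y, Z'⟩ ha ⟨e, f, h⟩
    simp only [Finset.mem_product, mem_unitPairs] at hq
    simp only [Finset.mem_sigma, mem_unitPairs, mem_factorizations_iff] at ha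
    dsimp only at e f h ⊢
    subst e f
    rw [single_mul_single_of_vComp h]
    simp only [vertexWeight_apply]
    have hl := h.l
    rw [hq.2.l] at hl
    rw [show T.bl M = T.bl U by
      change T.ver.tgt (T.l M) = T.ver.tgt (T.l U)
      rw [ha.2.l, hl.eq_of_id_left]]

end BoxAlgebra

end DoubleGroupoid

namespace DoubleGroupoid

open ArrowGroupoid Coalgebra

variable {P H V B k : Type*} [Field k] {T : DoubleGroupoid P H V B}

namespace BoxAlgebra

variable {w : T.Weight k}

/-- A property that holds for boxes and is preserved by linear combinations holds everywhere. -/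
theorem induction {p : BoxAlgebra w → Prop} (x : BoxAlgebra w) (single : ∀ A, p (single w A))
    (add : ∀ x y, p x → p y → p (x + y)) (smul : ∀ (c : k) x, p x → p (c • x)) (zero : p 0) :
    p x := by
  refine Finsupp.induction_linear (motive := p) x zero add fun A c => ?_
  have h := smul c _ (single A)
  rwa [show c • BoxAlgebra.single w A = Finsupp.single A c by
    exact (Finsupp.smul_single c A 1).trans (by rw [smul_eq_mul, mul_one])] at h

/-! ### The weak bialgebra axioms for the counit -/

/-- In a factorization `Y = Y₁Y₂` such that `b(Y₁)` is an identity, both factors have the same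
bottom left vertex. -/
theorem bl_eq_of_hComp {A Y₁ Y₂ Y : B}
    (h : T.HComp Y₁ Y₂ Y) (hA : T.IsCounitPair A Y₁) :
    T.bl Y₂ = T.bl Y₁ := by
  have e : T.ver.tgt (T.r Y₁) = T.hor.tgt (T.b Y₁) := (T.rb_eq_br Y₁).symm
  rw [hA.b_eq, T.hor.tgt_id] at e
  rw [← e, h.r_eq_l]

variable [Fintype H] [Fintype B] {ϑ : P → kˣ}

open Classical in
theorem counit_single_mul_single (A C : B) :
    counit (R := k) (single (T.vertexWeight ϑ) A * single (T.vertexWeight ϑ) C) =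
      if T.IsCounitPair A C then (((ϑ (T.bl C))⁻¹ : kˣ) : k) else 0 := by
  by_cases h : T.b A = T.t C
  · obtain ⟨E, hE⟩ := exists_vComp h
    rw [single_mul_single_of_vComp hE, counit_single, vertexWeight_apply,
      show T.bl E = T.bl C from hE.l.tgt]
    refine if_congr ⟨fun ⟨g, (hg : E = T.hid g)⟩ => ⟨g, hg ▸ hE⟩,
      fun ⟨g, hg⟩ => ⟨g, hE.unique hg⟩⟩ rfl rfl
  · rw [single_mul_single_of_ne h, map_zero, if_neg]
    rintro ⟨g, hg⟩
    exact h hg.1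

open Classical in
/-- Unit triples of the transposed double groupoid are the triples whose vertical composition is a
horizontal identity. -/
theorem counit_single_mul_single_mul_single (A Y C : B) :
    counit (R := k) (single (T.vertexWeight ϑ) A * single (T.vertexWeight ϑ) Y *
        single (T.vertexWeight ϑ) C) =
      if T.transpose.IsUnitTriple A Y C then (((ϑ (T.bl C))⁻¹ : kˣ) : k) else 0 := by
  rw [mul_assoc]
  by_cases h : T.b Y = T.t C
  · obtain ⟨M, hM⟩ := exists_vComp h
    rw [single_mul_single_of_vComp hM, counit_single_mul_single,
      show T.bl M = T.bl C from hM.l.tgt]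
    exact if_congr ⟨fun h => ⟨M, hM, h⟩, fun ⟨M', hM', h⟩ => hM.unique hM' ▸ h⟩ rfl rfl
  · rw [single_mul_single_of_ne h, mul_zero, map_zero, if_neg]
    rintro ⟨M, hM, -⟩
    exact h hM.1

open Classical in
theorem counit_mul_single (A Y C : B) :
    counit (R := k) (single (T.vertexWeight ϑ) A * single (T.vertexWeight ϑ) Y *
        single (T.vertexWeight ϑ) C) =
      ∑ p ∈ factorizations T Y, (ϑ (T.bl p.2) : k) *
        (counit (R := k) (single (T.vertexWeight ϑ) A * single (T.vertexWeight ϑ) p.1) *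
          counit (R := k) (single (T.vertexWeight ϑ) p.2 * single (T.vertexWeight ϑ) C)) := by
  rw [counit_single_mul_single_mul_single]
  split_ifs with h
  · obtain ⟨Y₁, Y₂, h₁, h₂, h₃⟩ := h.exists_split
    -- By definition, unit pairs of the transposed double groupoid are counit pairs.
    change T.IsCounitPair A Y₁ at h₁
    change T.IsCounitPair Y₂ C at h₂
    rw [Finset.sum_eq_single (Y₁, Y₂)]
    · rw [counit_single_mul_single, counit_single_mul_single, if_pos h₁, if_pos h₂,
        bl_eq_of_hComp h₃ h₁, Units.mul_inv_cancel_left]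
    · rintro ⟨X₁, X₂⟩ hp hne
      rw [mem_factorizations_iff] at hp
      rw [counit_single_mul_single, counit_single_mul_single]
      by_cases h₁' : T.IsCounitPair A X₁
      swap
      · simp [h₁']
      by_cases h₂' : T.IsCounitPair X₂ C
      swap
      · simp [h₂']
      refine absurd (Prod.ext ?_ ?_) hne
      · exact IsUnitPair.eq_right_of_t (T := T.transpose) h₁' h₁ (hp.l.symm.trans h₃.src)
      · exact IsUnitPair.eq_left_of_b (T := T.transpose) h₂' h₂ (hp.r.symm.trans h₃.tgt)
    · intro hn
      exact absurd (mem_factorizations_iff.2 h₃) hn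
  · refine (Finset.sum_eq_zero ?_).symm
    rintro ⟨X₁, X₂⟩ hp
    rw [mem_factorizations_iff] at hp
    rw [counit_single_mul_single, counit_single_mul_single]
    by_cases h₁ : T.IsCounitPair A X₁
    swap
    · simp [h₁]
    by_cases h₂ : T.IsCounitPair X₂ C
    swap
    · simp [h₂]
    exact absurd (IsUnitPair.isUnitTriple (T := T.transpose) h₁ h₂ hp) h

open Classical in
theorem counit_mul_single' (A Y C : B) :
    counit (R := k) (single (T.vertexWeight ϑ) A * single (T.vertexWeight ϑ) Y *
        single (T.vertexWeight ϑ) C) =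
      ∑ p ∈ factorizations T Y, (ϑ (T.bl p.2) : k) *
        (counit (R := k) (single (T.vertexWeight ϑ) p.1 * single (T.vertexWeight ϑ) C) *
          counit (R := k) (single (T.vertexWeight ϑ) A * single (T.vertexWeight ϑ) p.2)) := by
  rw [counit_single_mul_single_mul_single]
  split_ifs with h
  · obtain ⟨Y₂, Y₁, h₁, h₂, h₃⟩ := h.exists_split'
    -- By definition, unit pairs of the transposed double groupoid are counit pairs.
    change T.IsCounitPair A Y₂ at h₁
    change T.IsCounitPair Y₁ C at h₂
    rw [Finset.sum_eq_single (Y₁, Y₂)]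
    · rw [counit_single_mul_single, counit_single_mul_single, if_pos h₁, if_pos h₂, mul_comm,
        Units.inv_mul_cancel_right]
    · rintro ⟨X₁, X₂⟩ hp hne
      rw [mem_factorizations_iff] at hp
      rw [counit_single_mul_single, counit_single_mul_single]
      by_cases h₁' : T.IsCounitPair A X₂
      swap
      · simp [h₁']
      by_cases h₂' : T.IsCounitPair X₁ C
      swap
      · simp [h₂']
      refine absurd (Prod.ext ?_ ?_) hne
      · exact IsUnitPair.eq_left_of_t (T := T.transpose) h₂' h₂ (hp.l.symm.trans h₃.src)
      · exact IsUnitPair.eq_right_of_b (T := T.transpose) h₁' h₁ (hp.r.symm.trans h₃.tgt)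
    · intro hn
      exact absurd (mem_factorizations_iff.2 h₃) hn
  · refine (Finset.sum_eq_zero ?_).symm
    rintro ⟨X₁, X₂⟩ hp
    rw [mem_factorizations_iff] at hp
    rw [counit_single_mul_single, counit_single_mul_single]
    by_cases h₁ : T.IsCounitPair A X₂
    swap
    · simp [h₁]
    by_cases h₂ : T.IsCounitPair X₁ C
    swap
    · simp [h₂]
    exact absurd (IsUnitPair.isUnitTriple' (T := T.transpose) h₁ h₂ hp) h

theorem isWeakBialgebra (hϑ : T.IsNormalized ϑ) :
    IsWeakBialgebra k (BoxAlgebra (T.vertexWeight ϑ)) where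
  comul_mul x y := by
    induction x using BoxAlgebra.induction with
    | single A =>
      induction y using BoxAlgebra.induction with
      | single C => exact comul_single_mul_single hϑ A C
      | add y y' h h' => rw [mul_add, map_add, map_add, mul_add, h, h']
      | smul c y h => rw [mul_smul_comm, map_smul, map_smul, mul_smul_comm, h]
      | zero => rw [mul_zero, map_zero, mul_zero]
    | add x x' h h' => rw [add_mul, map_add, map_add, add_mul, h, h']
    | smul c x h => rw [smul_mul_assoc, map_smul, map_smul, smul_mul_assoc, h]
    | zero => rw [zero_mul, map_zero, zero_mul]
  comul_one := lTensor_comul_comul_one_eq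
  comul_one' := lTensor_comul_comul_one_eq'
  counit_mul x y z := by
    induction y using BoxAlgebra.induction with
    | single Y =>
      simp only [comul_single, map_sum, map_smul, TensorProduct.map_tmul, LinearMap.comp_apply,
        LinearMap.mul'_apply, LinearMap.mulLeft_apply, LinearMap.mulRight_apply, smul_eq_mul]
      induction x using BoxAlgebra.induction with
      | single A =>
        induction z using BoxAlgebra.induction with
        | single C => exact counit_mul_single A Y C
        | add z z' h h' => simp only [mul_add, map_add, h, h', Finset.sum_add_distrib]
        | smul c z h => simp only [mul_smul_comm, map_smul, h, Finset.smul_sum]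
        | zero => simp
      | add x x' h h' => simp only [mul_add, add_mul, map_add, h, h', Finset.sum_add_distrib]
      | smul c x h => simp only [mul_smul_comm, smul_mul_assoc, map_smul, h, Finset.smul_sum]
      | zero => simp
    | add y y' h h' => simp only [mul_add, add_mul, map_add, h, h']
    | smul c y h => simp only [mul_smul_comm, smul_mul_assoc, map_smul, h]
    | zero => simp only [mul_zero, zero_mul, map_zero]
  counit_mul' x y z := by
    induction y using BoxAlgebra.induction with
    | single Y =>
      simp only [comul_single, map_sum, map_smul, TensorProduct.map_tmul, LinearMap.comp_apply,
        LinearMap.mul'_apply, LinearMap.mulLeft_apply, LinearMap.mulRight_apply, smul_eq_mul]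
      induction x using BoxAlgebra.induction with
      | single A =>
        induction z using BoxAlgebra.induction with
        | single C => exact counit_mul_single' A Y C
        | add z z' h h' => simp only [mul_add, add_mul, map_add, h, h', Finset.sum_add_distrib]
        | smul c z h =>
          simp only [mul_smul_comm, smul_mul_assoc, map_smul, h, Finset.smul_sum]
        | zero => simp
      | add x x' h h' => simp only [mul_add, add_mul, map_add, h, h', Finset.sum_add_distrib]
      | smul c x h => simp only [mul_smul_comm, smul_mul_assoc, map_smul, h, Finset.smul_sum]
      | zero => simp
    | add y y' h h' => simp only [mul_add, add_mul, map_add, h, h']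
    | smul c y h => simp only [mul_smul_comm, smul_mul_assoc, map_smul, h]
    | zero => simp only [mul_zero, zero_mul, map_zero]

end BoxAlgebra

end DoubleGroupoid

/-! ### Uniqueness of the antipode -/

section Antipode

open Coalgebra in
theorem mul_map_comp_lTensor_comul {k H : Type*} [CommRing k] [Ring H] [Algebra k H]
    [Coalgebra k H] (S : H →ₗ[k] H) :
    LinearMap.mul' k H ∘ₗ TensorProduct.map S (LinearMap.mul' k H ∘ₗ LinearMap.lTensor H S) ∘ₗ
      LinearMap.lTensor H comul ∘ₗ comul =
    LinearMap.mul' k H ∘ₗ TensorProduct.map S (LinearMap.mul' k H ∘ₗ LinearMap.lTensor H S ∘ₗ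
      comul) ∘ₗ comul := by
  rw [← LinearMap.comp_assoc comul (LinearMap.lTensor H comul), LinearMap.map_comp_lTensor,
    LinearMap.comp_assoc comul (LinearMap.lTensor H S)]

open WithConv in
/-- Antipodes are unique: if `S` and `S'` are antipodes then, for the convolution product,
`S = S * (id * S) = S * (id * S') = (S * id) * S' = (S' * id) * S' = S'`. -/
theorem IsWeakAntipode.unique {k H : Type*} [CommRing k] [Ring H] [Algebra k H] [Coalgebra k H]
    {S S' : H →ₗ[k] H} (h : IsWeakAntipode S) (h' : IsWeakAntipode S') : S = S' := by
  have key : ∀ S : H →ₗ[k] H, IsWeakAntipode S →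
      toConv S * (toConv LinearMap.id * toConv S) = toConv S := by
    intro S h
    exact congrArg toConv ((mul_map_comp_lTensor_comul S).symm.trans h.mul_map_map)
  have e₁ : toConv LinearMap.id * toConv S = toConv LinearMap.id * toConv S' :=
    congrArg toConv (h.mul_lTensor.trans h'.mul_lTensor.symm)
  have e₂ : toConv S * toConv LinearMap.id = toConv S' * toConv LinearMap.id :=
    congrArg toConv (h.mul_rTensor.trans h'.mul_rTensor.symm)
  have e := key S h
  rw [e₁, ← mul_assoc, e₂, mul_assoc, key S' h'] at e
  exact (toConv_injective e).symm

end Antipode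

namespace DoubleGroupoid

open ArrowGroupoid Coalgebra

variable {P H V B k : Type*} [Field k] {T : DoubleGroupoid P H V B}

open Classical in
/-- The normalization condition reflected in a horizontal line, by vertical inversion of boxes. -/
theorem IsNormalized.sum_r_b_eq_one [Fintype B] {ϑ : P → kˣ} (hϑ : T.IsNormalized ϑ) {g : V}
    {x : H} (h : T.hor.tgt x = T.ver.tgt g) :
    ∑ Z : B with T.r Z = g ∧ T.b Z = x, (ϑ (T.hor.src (T.t Z)) : k) = 1 := by
  rw [← hϑ (T.ver.inv g) x (by rw [T.ver.src_inv, h])]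
  refine Finset.sum_nbij' T.vinv T.vinv ?_ ?_ ?_ ?_ ?_
  · intro Z hZ
    simp only [Finset.mem_filter, Finset.mem_univ, true_and] at hZ ⊢
    rw [r_vinv, t_vinv, hZ.1, hZ.2]
    exact ⟨rfl, rfl⟩
  · intro Z hZ
    simp only [Finset.mem_filter, Finset.mem_univ, true_and] at hZ ⊢
    rw [r_vinv, b_vinv, hZ.1, hZ.2, ArrowGroupoid.inv_inv]
    exact ⟨rfl, rfl⟩
  · exact fun Z _ => ArrowGroupoid.inv_inv Z
  · exact fun Z _ => ArrowGroupoid.inv_inv Z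
  · intro Z _
    rw [show T.bl (T.vinv Z) = T.hor.src (T.t Z) by
      change T.ver.tgt (T.l (T.vinv Z)) = _
      rw [← T.lb_eq_bl, ← b_vinv Z]]

namespace BoxAlgebra

variable {w : T.Weight k} {ϑ : P → kˣ} {A D E X Y Z : B}

/-! ### The antipode -/

variable (T) in
/-- The coefficient `ϑ(tr(A)) / ϑ(br(A))` of `A⁻¹` in the antipode of `A`. -/
def antipodeCoeff (ϑ : P → kˣ) (A : B) : kˣ :=
  ϑ (T.hor.tgt (T.t A)) / ϑ (T.hor.tgt (T.b A))

variable (T) in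
/-- The antipode, sending a box `A` to a multiple of its inverse in both directions. -/
noncomputable def antipode (ϑ : P → kˣ) :
    BoxAlgebra (T.vertexWeight ϑ) →ₗ[k] BoxAlgebra (T.vertexWeight ϑ) :=
  lift _ fun A => (antipodeCoeff T ϑ A : k) • single _ (T.inv A)

theorem antipode_single (A : B) : antipode T ϑ (single _ A) =
    (antipodeCoeff T ϑ A : k) • single _ (T.inv A) := lift_single _ _

theorem antipodeCoeff_right (h : T.HComp Y Z A) : antipodeCoeff T ϑ Z = antipodeCoeff T ϑ A := by
  rw [antipodeCoeff, antipodeCoeff, h.t.tgt, h.b.tgt]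

theorem mul_antipodeCoeff_left (h : T.HComp Y Z A) :
    (ϑ (T.bl Z) : k) * antipodeCoeff T ϑ Y = ϑ (T.hor.src (T.t Z)) := by
  have e : T.bl Z = T.hor.tgt (T.b Y) := by
    rw [h.b.tgt_eq_src]; exact (T.lb_eq_bl Z).symm
  rw [antipodeCoeff, h.t.tgt_eq_src, e, ← Units.val_mul, mul_div_cancel]

variable [Fintype H] [Fintype B]

open Classical in
theorem targetMap_single (A : B) :
    targetMap k (BoxAlgebra (T.vertexWeight ϑ)) (single _ A) =
      ∑ F : B with T.IsTargetTerm A F, (antipodeCoeff T ϑ A : k) • single _ F := by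
  change TensorProduct.lid k _ (LinearMap.rTensor _ counit
    (comul (R := k) (1 : BoxAlgebra (T.vertexWeight ϑ)) * (single _ A ⊗ₜ[k] 1))) = _
  rw [comul_one_eq]
  simp only [Finset.sum_mul, smul_mul_assoc, Algebra.TensorProduct.tmul_mul_tmul, mul_one, map_sum,
    map_smul, LinearMap.rTensor_tmul, TensorProduct.lid_tmul, counit_single_mul_single, smul_smul]
  refine Finset.sum_eq_sum_of_rel (fun p F => p.2 = F ∧ T.IsCounitPair p.1 A) ?_ ?_ ?_ ?_ ?_
  · rintro ⟨X, F⟩ hp hne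
    rw [mem_unitPairs] at hp
    by_cases h : T.IsCounitPair X A
    swap
    · exact absurd (by simp [h]) hne
    exact ⟨F, by simpa using ⟨X, hp, h⟩, rfl, h⟩
  · intro F hF
    simp only [Finset.mem_filter, Finset.mem_univ, true_and] at hF
    obtain ⟨X, hX, hA⟩ := hF
    exact ⟨(X, F), mem_unitPairs.2 hX, rfl, hA⟩
  · rintro p - F - F' - ⟨rfl, -⟩ ⟨rfl, -⟩
    rfl
  · rintro ⟨X, F⟩ hp ⟨X', F'⟩ hp' F'' - ⟨h₁, h₂⟩ ⟨h₁', h₂'⟩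
    rw [mem_unitPairs] at hp hp'
    dsimp only at h₁ h₂ h₁' h₂'
    subst h₁ h₁'
    rw [(h₂.vComp_l hp.l).right_cancel (h₂'.vComp_l hp'.l)]
  · rintro ⟨X, F⟩ hp F' hF ⟨h₁, h₂⟩
    simp only [Finset.mem_filter, Finset.mem_univ, true_and] at hF
    dsimp only at h₁ h₂
    subst h₁
    rw [if_pos h₂, vertexWeight_apply, hF.bl_eq, antipodeCoeff, hF.b_eq, T.hor.tgt_id,
      div_eq_mul_inv, Units.val_mul]

open Classical in
theorem sourceMap_single (A : B) :
    sourceMap k (BoxAlgebra (T.vertexWeight ϑ)) (single _ A) =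
      ∑ E : B with T.IsSourceTerm A E, single _ E := by
  change TensorProduct.rid k _ (LinearMap.lTensor _ counit
    ((1 ⊗ₜ[k] single _ A) * comul (R := k) (1 : BoxAlgebra (T.vertexWeight ϑ)))) = _
  rw [comul_one_eq]
  simp only [Finset.mul_sum, mul_smul_comm, Algebra.TensorProduct.tmul_mul_tmul, one_mul, map_sum,
    map_smul, LinearMap.lTensor_tmul, TensorProduct.rid_tmul, counit_single_mul_single, smul_smul]
  refine Finset.sum_eq_sum_of_rel (fun p E => p.1 = E ∧ T.IsCounitPair A p.2) ?_ ?_ ?_ ?_ ?_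
  · rintro ⟨E, Y⟩ hp hne
    rw [mem_unitPairs] at hp
    by_cases h : T.IsCounitPair A Y
    swap
    · exact absurd (by simp [h]) hne
    exact ⟨E, by simpa using ⟨Y, hp, h⟩, rfl, h⟩
  · intro E hE
    simp only [Finset.mem_filter, Finset.mem_univ, true_and] at hE
    obtain ⟨Y, hY, hA⟩ := hE
    exact ⟨(E, Y), mem_unitPairs.2 hY, rfl, hA⟩
  · rintro p - E - E' - ⟨rfl, -⟩ ⟨rfl, -⟩
    rfl
  · rintro ⟨E, Y⟩ hp ⟨E', Y'⟩ hp' E'' - ⟨h₁, h₂⟩ ⟨h₁', h₂'⟩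
    rw [mem_unitPairs] at hp hp'
    dsimp only at h₁ h₂ h₁' h₂'
    subst h₁ h₁'
    rw [(h₂.vComp_r hp.r).left_cancel (h₂'.vComp_r hp'.r)]
  · rintro ⟨E, Y⟩ hp E' hE ⟨h₁, h₂⟩
    dsimp only at h₁ h₂
    subst h₁
    rw [if_pos h₂, vertexWeight_apply, Units.mul_inv, one_smul]

open Classical in
theorem mul_lTensor_antipode (hϑ : T.IsNormalized ϑ) (A : B) :
    LinearMap.mul' k _ (LinearMap.lTensor _ (antipode T ϑ)
      (comul (R := k) (single (T.vertexWeight ϑ) A))) =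
      ∑ F : B with T.IsTargetTerm A F, (antipodeCoeff T ϑ A : k) • single _ F := by
  simp only [comul_single, map_sum, map_smul, LinearMap.lTensor_tmul, antipode_single,
    LinearMap.mul'_apply, mul_smul_comm, smul_smul]
  -- Insert the normalization condition for the right edge of `A` and the edge `x` such that
  -- `t(F) x = t(A)`.
  have hsum : ∀ F ∈ (Finset.univ.filter fun F : B => T.IsTargetTerm A F),
      (antipodeCoeff T ϑ A : k) • single (T.vertexWeight ϑ) F =
      ∑ Z : B with T.r Z = T.r A ∧ T.hor.IsComp (T.t F) (T.t Z) (T.t A),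
        ((ϑ (T.bl Z) : k) * antipodeCoeff T ϑ A) • single (T.vertexWeight ϑ) F := by
    intro F hF
    simp only [Finset.mem_filter, Finset.mem_univ, true_and] at hF
    obtain ⟨x, hx⟩ := exists_isComp_left hF.src_t
    have e : ∀ Z ∈ (Finset.univ : Finset B),
        (T.r Z = T.r A ∧ T.hor.IsComp (T.t F) (T.t Z) (T.t A)) ↔
        (T.r Z = T.r A ∧ T.t Z = x) := fun Z _ =>
      and_congr_right fun _ => ⟨fun h => h.left_cancel hx, fun h => h ▸ hx⟩
    rw [Finset.filter_congr e, ← Finset.sum_smul, ← Finset.sum_mul, hϑ, one_mul]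
    rw [← hx.tgt]
    exact T.rt_eq_tr A
  rw [Finset.sum_congr rfl hsum, Finset.sum_sigma']
  refine Finset.sum_eq_sum_of_rel (fun p a => T.VComp p.1 (T.inv p.2) a.1 ∧ p.2 = a.2)
    ?_ ?_ ?_ ?_ ?_
  · rintro ⟨Y, Z⟩ hp hne
    rw [mem_factorizations_iff] at hp
    by_cases h : T.b Y = T.t (T.inv Z)
    swap
    · exact absurd (by simp [single_mul_single_of_ne h]) hne
    have hb := hp.b
    dsimp only at hb
    rw [h, t_inv] at hb
    obtain ⟨F, hF, hAF⟩ := hp.exists_isTargetTerm (hb.unique (IsComp.inv_self _))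
    refine ⟨⟨F, Z⟩, ?_, hF, rfl⟩
    simp only [Finset.mem_sigma, Finset.mem_filter, Finset.mem_univ, true_and]
    refine ⟨hAF, hp.r.symm, ?_⟩
    rw [hF.t]
    exact hp.t
  · rintro ⟨F, Z⟩ ha
    simp only [Finset.mem_sigma, Finset.mem_filter, Finset.mem_univ, true_and] at ha
    obtain ⟨Y, hY, hF⟩ := ha.1.exists_hComp ha.2.1 ha.2.2
    exact ⟨(Y, Z), mem_factorizations_iff.2 hY, hF, rfl⟩
  · rintro ⟨Y, Z⟩ - ⟨F, Z'⟩ - ⟨F', Z''⟩ - ⟨h₁, h₂⟩ ⟨h₁', h₂'⟩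
    dsimp only at h₁ h₂ h₁' h₂'
    rw [h₁.unique h₁', ← h₂, ← h₂']
  · rintro ⟨Y, Z⟩ hp ⟨Y', Z'⟩ hp' ⟨F, Z''⟩ - ⟨h₁, h₂⟩ ⟨h₁', h₂'⟩
    rw [mem_factorizations_iff] at hp hp'
    dsimp only at h₁ h₂ h₁' h₂' hp hp'
    subst h₂ h₂'
    rw [hp.right_cancel hp']
  · rintro ⟨Y, Z⟩ hp ⟨F, Z'⟩ - ⟨h₁, h₂⟩
    rw [mem_factorizations_iff] at hp
    dsimp only at h₁ h₂ ⊢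
    subst h₂
    rw [single_mul_single_of_vComp h₁, vertexWeight_apply, antipodeCoeff_right hp]

open Classical in
theorem mul_rTensor_antipode (hϑ : T.IsNormalized ϑ) (A : B) :
    LinearMap.mul' k _ (LinearMap.rTensor _ (antipode T ϑ)
      (comul (R := k) (single (T.vertexWeight ϑ) A))) =
      ∑ E : B with T.IsSourceTerm A E, single _ E := by
  simp only [comul_single, map_sum, map_smul, LinearMap.rTensor_tmul, antipode_single,
    LinearMap.mul'_apply, smul_mul_assoc, smul_smul]
  -- Insert the reflected normalization condition for the right edge of `A` and the bottom edge
  -- of `E`.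
  have hsum : ∀ E ∈ (Finset.univ.filter fun E : B => T.IsSourceTerm A E),
      single (T.vertexWeight ϑ) E =
      ∑ Z : B with T.r Z = T.r A ∧ T.b Z = T.b E,
        (ϑ (T.hor.src (T.t Z)) : k) • single (T.vertexWeight ϑ) E := by
    intro E hE
    simp only [Finset.mem_filter, Finset.mem_univ, true_and] at hE
    rw [← Finset.sum_smul, hϑ.sum_r_b_eq_one hE.tgt_b, one_smul]
  rw [Finset.sum_congr rfl hsum, Finset.sum_sigma']
  refine Finset.sum_eq_sum_of_rel (fun p a => T.VComp (T.inv p.1) p.2 a.1 ∧ p.2 = a.2)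
    ?_ ?_ ?_ ?_ ?_
  · rintro ⟨Y, Z⟩ hp hne
    rw [mem_factorizations_iff] at hp
    by_cases h : T.b (T.inv Y) = T.t Z
    swap
    · exact absurd (by simp [single_mul_single_of_ne h]) hne
    have ht := hp.t
    dsimp only at ht
    rw [← h, b_inv] at ht
    obtain ⟨E, hE, hAE⟩ := hp.exists_isSourceTerm (ht.unique (IsComp.self_inv _))
    refine ⟨⟨E, Z⟩, ?_, hE, rfl⟩
    simp only [Finset.mem_sigma, Finset.mem_filter, Finset.mem_univ, true_and]
    exact ⟨hAE, hp.r.symm, hE.b.symm⟩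
  · rintro ⟨E, Z⟩ ha
    simp only [Finset.mem_sigma, Finset.mem_filter, Finset.mem_univ, true_and] at ha
    obtain ⟨Y, hY, hE⟩ := ha.1.exists_hComp ha.2.1 ha.2.2
    exact ⟨(Y, Z), mem_factorizations_iff.2 hY, hE, rfl⟩
  · rintro ⟨Y, Z⟩ - ⟨E, Z'⟩ - ⟨E', Z''⟩ - ⟨h₁, h₂⟩ ⟨h₁', h₂'⟩
    dsimp only at h₁ h₂ h₁' h₂'
    rw [h₁.unique h₁', ← h₂, ← h₂']
  · rintro ⟨Y, Z⟩ hp ⟨Y', Z'⟩ hp' ⟨E, Z''⟩ - ⟨h₁, h₂⟩ ⟨h₁', h₂'⟩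
    rw [mem_factorizations_iff] at hp hp'
    dsimp only at h₁ h₂ h₁' h₂' hp hp'
    subst h₂ h₂'
    rw [hp.right_cancel hp']
  · rintro ⟨Y, Z⟩ hp ⟨E, Z'⟩ - ⟨h₁, h₂⟩
    rw [mem_factorizations_iff] at hp
    dsimp only at h₁ h₂ hp ⊢
    subst h₂
    rw [single_mul_single_of_vComp h₁, vertexWeight_apply, mul_antipodeCoeff_left hp]

open Classical in
theorem single_inv_mul_sum_isTargetTerm (h : T.HComp X Y A) :
    single w (T.inv X) * ∑ F : B with T.IsTargetTerm Y F, single w F =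
      if T.b Y = T.hor.id (T.hor.tgt (T.b A)) then single w (T.inv A) else 0 := by
  rw [Finset.mul_sum]
  split_ifs with hY
  · obtain ⟨F, hF, hAF⟩ := h.exists_inv_vComp hY
    rw [Finset.sum_eq_single F, single_mul_single_of_vComp hAF]
    · intro F' hF' hne
      simp only [Finset.mem_filter, Finset.mem_univ, true_and] at hF'
      exact single_mul_single_of_ne fun e => hne (hF'.eq_of_t hF (e.symm.trans hAF.b_eq_t))
    · intro hn
      exact absurd (by simpa using hF) hn
  · refine Finset.sum_eq_zero fun F hF => ?_
    simp only [Finset.mem_filter, Finset.mem_univ, true_and] at hF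
    refine absurd ?_ hY
    rw [h.b.tgt, hF.b_eq, T.hor.tgt_id]

open Classical in
/-- The antipode axiom `S * id * S = S`, where the product `id * S` has been computed. -/
theorem mul_map_antipode_targetMap (hϑ : T.IsNormalized ϑ) (A : B) :
    LinearMap.mul' k _ (TensorProduct.map (antipode T ϑ)
      (targetMap k (BoxAlgebra (T.vertexWeight ϑ)))
      (comul (R := k) (single (T.vertexWeight ϑ) A))) = antipode T ϑ (single _ A) := by
  simp only [comul_single, map_sum, map_smul, TensorProduct.map_tmul, antipode_single,
    LinearMap.mul'_apply, targetMap_single, ← Finset.smul_sum, smul_mul_smul_comm, smul_smul]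
  have hsum := hϑ.sum_r_b_eq_one (g := T.r A) (x := T.hor.id (T.hor.tgt (T.b A)))
    (by rw [T.hor.tgt_id]; exact T.rb_eq_br A)
  rw [show (antipodeCoeff T ϑ A : k) • single (T.vertexWeight ϑ) (T.inv A) =
    ∑ Z : B with T.r Z = T.r A ∧ T.b Z = T.hor.id (T.hor.tgt (T.b A)),
      ((ϑ (T.hor.src (T.t Z)) : k) * antipodeCoeff T ϑ A) •
        single (T.vertexWeight ϑ) (T.inv A) by
    rw [← Finset.sum_smul, ← Finset.sum_mul, hsum, one_mul]]
  refine Finset.sum_eq_sum_of_rel (fun p Z => p.2 = Z) ?_ ?_ ?_ ?_ ?_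
  · rintro ⟨X, Y⟩ hp hne
    rw [mem_factorizations_iff] at hp
    rw [single_inv_mul_sum_isTargetTerm hp] at hne
    refine ⟨Y, ?_, rfl⟩
    simp only [Finset.mem_filter, Finset.mem_univ, true_and]
    refine ⟨hp.r.symm, ?_⟩
    by_contra h
    exact hne (by rw [if_neg h, smul_zero])
  · intro Y hY
    simp only [Finset.mem_filter, Finset.mem_univ, true_and] at hY
    obtain ⟨X, hX⟩ := exists_hComp_right hY.1
    exact ⟨(X, Y), mem_factorizations_iff.2 hX, rfl⟩
  · rintro p - Z - Z' - rfl rfl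
    rfl
  · rintro ⟨X, Y⟩ hp ⟨X', Y'⟩ hp' Z - h h'
    rw [mem_factorizations_iff] at hp hp'
    dsimp only at h h' hp hp'
    subst h h'
    rw [hp.right_cancel hp']
  · rintro ⟨X, Y⟩ hp Z hZ h
    rw [mem_factorizations_iff] at hp
    simp only [Finset.mem_filter, Finset.mem_univ, true_and] at hZ
    dsimp only at h hp ⊢
    subst h
    rw [single_inv_mul_sum_isTargetTerm hp, if_pos hZ.2, antipodeCoeff_right hp, ← mul_assoc,
      vertexWeight_apply, mul_antipodeCoeff_left hp]

theorem isWeakAntipode (hϑ : T.IsNormalized ϑ) : IsWeakAntipode (antipode T ϑ) := by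
  classical
  have h₁ : LinearMap.mul' k (BoxAlgebra (T.vertexWeight ϑ)) ∘ₗ
      LinearMap.lTensor _ (antipode T ϑ) ∘ₗ comul = targetMap k _ :=
    hom_ext fun A => (mul_lTensor_antipode hϑ A).trans (targetMap_single A).symm
  refine ⟨h₁, hom_ext fun A => (mul_rTensor_antipode hϑ A).trans (sourceMap_single A).symm, ?_⟩
  rw [mul_map_comp_lTensor_comul, h₁]
  exact hom_ext fun A => mul_map_antipode_targetMap hϑ A

end BoxAlgebra

end DoubleGroupoid

namespace DoubleGroupoid

open ArrowGroupoid Coalgebra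

variable {P H V B k : Type*} [Field k] {T : DoubleGroupoid P H V B}

namespace BoxAlgebra

variable {ϑ : P → kˣ} {D E : B}

/-! ### Regularity -/

theorem antipode_antipode_single (E : B) : antipode T ϑ (antipode T ϑ (single _ E)) =
    ((antipodeCoeff T ϑ E * antipodeCoeff T ϑ (T.inv E) : kˣ) : k) • single _ E := by
  rw [antipode_single, map_smul, antipode_single, smul_smul, inv_inv, Units.val_mul]

/-- The scalar by which the square of the antipode acts on a box, in terms of its four corners. -/
theorem antipodeCoeff_mul_antipodeCoeff_inv (E : B) :
    antipodeCoeff T ϑ E * antipodeCoeff T ϑ (T.inv E) =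
      ϑ (T.hor.tgt (T.t E)) / ϑ (T.hor.tgt (T.b E)) *
        (ϑ (T.hor.src (T.b E)) / ϑ (T.hor.src (T.t E))) := by
  rw [antipodeCoeff, antipodeCoeff, t_inv, b_inv, T.hor.tgt_inv, T.hor.tgt_inv]

theorem src_b_eq_src_t_of_isId_l (h : T.ver.IsId (T.l E)) :
    T.hor.src (T.b E) = T.hor.src (T.t E) := by
  obtain ⟨p, hp⟩ := h
  refine (T.lb_eq_bl E).trans (Eq.trans ?_ (T.lt_eq_tl E).symm)
  rw [show T.boxH.src E = _ from hp, T.ver.src_id, T.ver.tgt_id]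

theorem tgt_b_eq_tgt_t_of_isId_r (h : T.ver.IsId (T.r E)) :
    T.hor.tgt (T.b E) = T.hor.tgt (T.t E) := by
  obtain ⟨p, hp⟩ := h
  refine (T.rb_eq_br E).trans (Eq.trans ?_ (T.rt_eq_tr E).symm)
  rw [show T.boxH.tgt E = _ from hp, T.ver.src_id, T.ver.tgt_id]

theorem antipode_antipode_of_isId_l (hconst : ∀ p q, T.core.Connected p q → ϑ p = ϑ q)
    (h : T.ver.IsId (T.l E)) : antipode T ϑ (antipode T ϑ (single _ E)) = single _ E := by
  rw [antipode_antipode_single, antipodeCoeff_mul_antipodeCoeff_inv,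
    hconst _ _ (core_connected_of_isId_l h), src_b_eq_src_t_of_isId_l h, div_self', div_self',
    mul_one, Units.val_one, one_smul]

theorem antipode_antipode_of_isId_r (hconst : ∀ p q, T.core.Connected p q → ϑ p = ϑ q)
    (h : T.ver.IsId (T.r E)) : antipode T ϑ (antipode T ϑ (single _ E)) = single _ E := by
  rw [antipode_antipode_single, antipodeCoeff_mul_antipodeCoeff_inv,
    hconst _ _ (core_connected_of_isId_r h), tgt_b_eq_tgt_t_of_isId_r h, div_self', div_self',
    mul_one, Units.val_one, one_smul]

variable [Fintype H] [Fintype B]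

theorem antipode_antipode_sourceMap (hconst : ∀ p q, T.core.Connected p q → ϑ p = ϑ q)
    (x : BoxAlgebra (T.vertexWeight ϑ)) :
    antipode T ϑ (antipode T ϑ (sourceMap k _ x)) = sourceMap k _ x := by
  classical
  suffices h : antipode T ϑ ∘ₗ antipode T ϑ ∘ₗ sourceMap k _ = sourceMap k _ from
    LinearMap.congr_fun h x
  refine hom_ext fun A => ?_
  simp only [LinearMap.comp_apply, sourceMap_single, map_sum]
  refine Finset.sum_congr rfl fun E hE => antipode_antipode_of_isId_l hconst ?_
  simp only [Finset.mem_filter, Finset.mem_univ, true_and] at hE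
  exact hE.l_eq

theorem antipode_antipode_targetMap (hconst : ∀ p q, T.core.Connected p q → ϑ p = ϑ q)
    (x : BoxAlgebra (T.vertexWeight ϑ)) :
    antipode T ϑ (antipode T ϑ (targetMap k _ x)) = targetMap k _ x := by
  classical
  suffices h : antipode T ϑ ∘ₗ antipode T ϑ ∘ₗ targetMap k _ = targetMap k _ from
    LinearMap.congr_fun h x
  refine hom_ext fun A => ?_
  simp only [LinearMap.comp_apply, targetMap_single, map_sum, map_smul]
  refine Finset.sum_congr rfl fun E hE => ?_
  simp only [Finset.mem_filter, Finset.mem_univ, true_and] at hE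
  rw [antipode_antipode_of_isId_r hconst hE.r_eq]

/-- If the square of the antipode fixes the value of the source map at `D⁻¹`, for a core box `D`,
then `ϑ` agrees at both ends of `D`: compare the coefficients of `D`. -/
theorem eq_of_antipode_antipode_sourceMap (hD : T.IsCore D)
    (h : antipode T ϑ (antipode T ϑ (sourceMap k _ (single _ (T.inv D)))) =
      sourceMap k _ (single _ (T.inv D))) :
    ϑ (T.hor.tgt (T.t D)) = ϑ (T.hor.src (T.t D)) := by
  classical
  rw [sourceMap_single] at h
  simp only [map_sum, antipode_antipode_single] at h
  have e := congrArg (lift (T.vertexWeight ϑ) fun E => if E = D then (1 : k) else 0) h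
  simp only [map_sum, map_smul, lift_single, smul_eq_mul, mul_ite, mul_one, mul_zero,
    Finset.sum_ite_eq', Finset.mem_filter, Finset.mem_univ, true_and, if_pos hD.isSourceTerm_inv,
    Units.val_eq_one] at e
  rw [antipodeCoeff_mul_antipodeCoeff_inv, src_b_eq_src_t_of_isId_l hD.1, div_self', mul_one,
    div_eq_one, hD.b_eq, T.hor.tgt_id] at e
  exact e

/-- The box algebra of a normalized vertex weight is regular if and only if the weight is constant
on the connected components of the core groupoid. -/
theorem isRegularWeakHopfAlgebra_iff (hϑ : T.IsNormalized ϑ) :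
    IsRegularWeakHopfAlgebra k (BoxAlgebra (T.vertexWeight ϑ)) ↔
      ∀ p q : P, T.core.Connected p q → ϑ p = ϑ q := by
  constructor
  · rintro ⟨-, S, hS, hs, -⟩ p q ⟨D, rfl, rfl⟩
    obtain rfl := hS.unique (isWeakAntipode hϑ)
    exact eq_of_antipode_antipode_sourceMap D.2 (hs _ ⟨_, rfl⟩)
  · intro h
    refine ⟨isWeakBialgebra hϑ, antipode T ϑ, isWeakAntipode hϑ, ?_, ?_⟩
    · rintro _ ⟨x, rfl⟩
      exact antipode_antipode_sourceMap h x
    · rintro _ ⟨x, rfl⟩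
      exact antipode_antipode_targetMap h x

end BoxAlgebra

/-! ### The corner weight -/

/-- The corner weight is the vertex weight of `p ↦ 1 / #{U : r(U) = id p, t(U) = id p}`. -/
theorem exists_cornerWeight_eq_vertexWeight (T : DoubleGroupoid P H V B) [CharZero k] [Fintype B]
    (hT : T.Filling) : ∃ ϑ : P → kˣ, T.cornerWeight k = T.vertexWeight ϑ ∧ T.IsNormalized ϑ ∧
      ∀ p q, T.core.Connected p q → ϑ p = ϑ q := by
  classical
  have hne : ∀ p, (T.urCorner (T.ver.id p) (T.hor.id p) : k) ≠ 0 := fun p =>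
    Nat.cast_ne_zero.2 (hT _ _ (by rw [T.hor.tgt_id, T.ver.src_id]))
  refine ⟨fun p => (Units.mk0 _ (hne p))⁻¹, ?_, ?_, ?_⟩
  · have e : (T.cornerWeight k).toFun =
        (T.vertexWeight fun p => (Units.mk0 _ (hne p))⁻¹).toFun := by
      funext X
      refine congrArg Inv.inv (Units.ext ?_)
      exact congrArg (Nat.cast (R := k)) (urCorner_eq X)
    generalize T.cornerWeight k = w at e
    cases w
    cases e
    rfl
  · intro g x h
    have e : ∀ U ∈ (Finset.univ.filter fun U : B => T.r U = g ∧ T.t U = x),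
        (((Units.mk0 _ (hne (T.bl U)))⁻¹ : kˣ) : k) = (T.urCorner g x : k)⁻¹ := by
      intro U hU
      simp only [Finset.mem_filter, Finset.mem_univ, true_and] at hU
      rw [Units.val_inv_eq_inv_val, Units.val_mk0, ← urCorner_eq U, hU.1, hU.2]
    rw [Finset.sum_congr rfl e, Finset.sum_const, nsmul_eq_mul]
    have hcard : (Finset.univ.filter fun U : B => T.r U = g ∧ T.t U = x).card =
        T.urCorner g x := by
      rw [urCorner, Nat.card_eq_fintype_card, Fintype.card_subtype]
    rw [hcard, mul_inv_cancel₀ (Nat.cast_ne_zero.2 (hT g x h))]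
  · intro p q h
    refine congrArg Inv.inv (Units.ext ?_)
    refine congrArg (Nat.cast (R := k)) ?_
    rw [urCorner_id_eq_card_core, urCorner_id_eq_card_core, h.card_tgt_eq]

end DoubleGroupoid

theorem mainTheorem5 {P H V B k : Type*} [Fintype H] [Fintype B] [Field k] [CharZero k]
    (T : DoubleGroupoid P H V B) :
    (∀ ϑ : P → kˣ, T.IsNormalized ϑ →
      IsWeakHopfAlgebra k (DoubleGroupoid.BoxAlgebra (T.vertexWeight ϑ)) ∧
      (IsRegularWeakHopfAlgebra k (DoubleGroupoid.BoxAlgebra (T.vertexWeight ϑ)) ↔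
        ∀ p q : P, T.core.Connected p q → ϑ p = ϑ q)) ∧
    (T.Filling →
      IsRegularWeakHopfAlgebra k (DoubleGroupoid.BoxAlgebra (T.cornerWeight k))) := by
  refine ⟨fun ϑ hϑ => ⟨⟨DoubleGroupoid.BoxAlgebra.isWeakBialgebra hϑ, _,
    DoubleGroupoid.BoxAlgebra.isWeakAntipode hϑ⟩,
    DoubleGroupoid.BoxAlgebra.isRegularWeakHopfAlgebra_iff hϑ⟩, fun hT => ?_⟩
  obtain ⟨ϑ, e, hϑ, hconst⟩ := T.exists_cornerWeight_eq_vertexWeight (k := k) hT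
  rw [e]
  exact (DoubleGroupoid.BoxAlgebra.isRegularWeakHopfAlgebra_iff hϑ).2 hconst
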